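/- Let $S^7\subset\mathbb C^4$ be the unit sphere for $\langle z,w\rangle=\mathrm{Re}\sum_a z_a\overline{w_a}$, with the induced metric $g$ (of constant curvature $1$), its Levi-Civita connection $\nabla^g$ and the outward unit normal $N_z=z$. Identify $\mathbb C^4$ with $\mathbb H^2$ by $(z_1,z_2,z_3,z_4)\leftrightarrow(z_1+z_2j,\,z_3+z_4j)$ and let $J_1,J_2,J_3$ be left multiplication by $i$, $j$, $k=ij$; thus $J_1z=iz$, $J_2(z_1,z_2,z_3,z_4)=(-\bar z_2,\bar z_1,-\bar z_4,\bar z_3)$ and $J_3=J_1J_2$. For $s=1,2,3$ let $\xi_s=-J_sN$, let $\psi_s(X)$ be the tangential part of $J_sX$ and $\eta_s(X)=g(\xi_s,X)$, so that $J_sX=\psi_s(X)+\eta_s(X)N$, and put $\Phi_s(X,Y)=g(X,\psi_s(Y))$. Let $\Omega=\eta_2\wedge\Phi_2-\eta_3\wedge\Phi_3$, where $(\eta\wedge\Phi)(X,Y,Z)=\eta(X)\Phi(Y,Z)+\eta(Y)\Phi(Z,X)+\eta(Z)\Phi(X,Y)$, and define $\Theta,\widetilde\Theta$ by $$g(\Theta(X,Y),Z)=\Omega(X,Y,Z),\qquad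 g(\widetilde\Theta(X,Y),Z)=\Omega(X,Y,\psi_1(Z)).$$ For $r\in\mathbb R$ and $q\in\mathbb C$ let $\nabla$ be the $SU(4)$-invariant connection $$\nabla_XY=\nabla^g_XY+r\big(\Phi_1(X,Y)\xi_1-\eta_1(X)\psi_1(Y)+\eta_1(Y)\psi_1(X)\big)+\mathrm{Re}(q)\,\Theta(X,Y)+\mathrm{Im}(q)\,\widetilde\Theta(X,Y).$$ Let $R^\nabla(X,Y)Z=\nabla_X\nabla_YZ-\nabla_Y\nabla_XZ-\nabla_{[X,Y]}Z$, let $\mathrm{Ric}^\nabla(Y,Z)=\mathrm{tr}\big(X\mapsto R^\nabla(X,Y)Z\big)$, let $\mathrm{Sym}(\mathrm{Ric}^\nabla)$ be its symmetric part and $s^\nabla=\mathrm{tr}_g\mathrm{Ric}^\nabla$. Call $(S^7,g,\nabla)$ $\nabla$-Einstein if $\nabla$ is a metric connection ($\nabla g=0$) whose torsion $T$ is totally skew-symmetric (that is, $g(T(X,Y),Z)$ is a $3$-form) and $\mathrm{Sym}(\mathrm{Ric}^\nabla)=\frac{s^\nabla}{7}\,g$. Then, for all $r\in\mathbb R$ and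 $q\in\mathbb C$: 1. $\mathrm{Sym}(\mathrm{Ric}^\nabla)=(6-2r^2-4|q|^2)\,g+4(|q|^2-r^2)\,\eta_1\otimes\eta_1$; 2. $s^\nabla=6(7-3r^2-4|q|^2)$; 3. $(S^7,g,\nabla)$ is $\nabla$-Einstein if and only if $|q|^2=r^2$; 4. if $|q|^2=r^2$, then $\mathrm{Sym}(\mathrm{Ric}^\nabla)=6(1-r^2)\,g$. -/

import Mathlib

open Metric Module Bundle FiberBundle VectorField
open scoped Manifold ContDiff ComplexConjugate Topology

noncomputable section

/-! ### Affine connections on a Riemannian manifold: curvature, torsion, the Einstein equation -/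

section General

variable {E : Type*} [NormedAddCommGroup E] [NormedSpace ℝ E] [FiniteDimensional ℝ E]
  {H : Type*} [TopologicalSpace H] {I : ModelWithCorners ℝ E H}
  {M : Type*} [TopologicalSpace M] [ChartedSpace H M]

instance tangentSpaceFiniteDimensional (x : M) : FiniteDimensional ℝ (TangentSpace I x) :=
  inferInstanceAs (FiniteDimensional ℝ E)

theorem mvfderiv_inner {V : Type*} [NormedAddCommGroup V] [InnerProductSpace ℝ V] {F G : M → V}
    {x : M} (hF : MDifferentiableAt I 𝓘(ℝ, V) F x) (hG : MDifferentiableAt I 𝓘(ℝ, V) G x)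
    (u : TangentSpace I x) :
    mvfderiv I (fun y => (inner ℝ (F y) (G y) : ℝ)) x u =
      inner ℝ (mvfderiv I F x u) (G x) + inner ℝ (F x) (mvfderiv I G x u) := by
  have h1 := (isBoundedBilinearMap_inner (𝕜 := ℝ) (E := V)).hasFDerivAt (F x, G x)
  have h0 : HasMFDerivAt I 𝓘(ℝ, V × V) (fun y => (F y, G y)) x
      ((mvfderiv I F x).prod (mvfderiv I G x)) :=
    ⟨hF.hasMFDerivAt.1.prodMk hG.hasMFDerivAt.1, hF.hasMFDerivAt.2.prodMk hG.hasMFDerivAt.2⟩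
  have h2 := HasMFDerivAt.comp x (g := fun p : V × V => (inner ℝ p.1 p.2 : ℝ))
    h1.hasMFDerivAt h0
  have h3 := congrArg (fun L => L u) h2.mfderiv
  exact h3.trans (add_comm _ _)

variable [IsManifold I ∞ M]

namespace CovariantDerivative

/-- `R(X,Y)Z = ∇_X ∇_Y Z - ∇_Y ∇_X Z - ∇_{[X,Y]} Z` for vector fields `X`, `Y`, `Z`. Recall that
Mathlib writes `cov Z x (X x)` for `(∇_X Z)(x)`. -/
def curvatureField (cov : CovariantDerivative I E (TangentSpace I : M → Type _))
    (X Y Z : Π x : M, TangentSpace I x) (x : M) : TangentSpace I x :=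
  cov (fun y => cov Z y (Y y)) x (X x) - cov (fun y => cov Z y (X y)) x (Y x)
    - cov Z x (mlieBracket I X Y x)

/-- The curvature tensor at a point, `R_x(u, v) w`: the value at `x` of `R(X,Y)Z` for vector fields
`X`, `Y`, `Z` that extend `u`, `v`, `w` and are smooth near `x`. -/
def curvature (cov : CovariantDerivative I E (TangentSpace I : M → Type _)) (x : M)
    (u v w : TangentSpace I x) : TangentSpace I x :=
  cov.curvatureField (extend E u) (extend E v) (extend E w) x

variable [RiemannianBundle (fun x : M => TangentSpace I x)]

/-- The Ricci tensor: `Ric(v, w)` is the trace of `u ↦ R(u, v) w`. -/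
def ricci (cov : CovariantDerivative I E (TangentSpace I : M → Type _)) (x : M)
    (v w : TangentSpace I x) : ℝ :=
  let e := stdOrthonormalBasis ℝ (TangentSpace I x)
  ∑ i, inner ℝ (cov.curvature x (e i) v w) (e i)

/-- The symmetric part of the Ricci tensor. -/
def symRicci (cov : CovariantDerivative I E (TangentSpace I : M → Type _)) (x : M)
    (v w : TangentSpace I x) : ℝ :=
  (cov.ricci x v w + cov.ricci x w v) / 2

/-- The scalar curvature: the trace of the Ricci tensor with respect to the metric. -/
def scalarCurvature (cov : CovariantDerivative I E (TangentSpace I : M → Type _)) (x : M) : ℝ :=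
  let e := stdOrthonormalBasis ℝ (TangentSpace I x)
  ∑ i, cov.ricci x (e i) (e i)

/-- The torsion is totally skew-symmetric: `ω(u, v, w) = g(T(u, v), w)` is alternating. -/
def HasTotallySkewTorsion (cov : CovariantDerivative I E (TangentSpace I : M → Type _)) : Prop :=
  ∀ (x : M) (u v w : TangentSpace I x),
    inner ℝ (cov.torsion x u v) w = - inner ℝ (cov.torsion x v u) w ∧
    inner ℝ (cov.torsion x u v) w = - inner ℝ (cov.torsion x u w) v

variable [IsContMDiffRiemannianBundle I 1 E (fun x : M => TangentSpace I x)]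

/-- `∇` is a metric connection (Mathlib's `IsMetricCompatible`, for the tangent bundle). -/
def IsMetric (cov : CovariantDerivative I E (TangentSpace I : M → Type _)) : Prop := by
  refine CovariantDerivative.IsMetricCompatible (I := I) (F := E)
    (V := fun x : M => TangentSpace I x) ?_
  exact cov

/-- `∇` is a metric connection if and only if `X (g(Y, Z)) = g(∇_X Y, Z) + g(Y, ∇_X Z)`. -/
theorem isMetric_iff (cov : CovariantDerivative I E (TangentSpace I : M → Type _)) :
    cov.IsMetric ↔ ∀ (x : M) (X Y Z : Π x : M, TangentSpace I x),
      MDiffAt (T% X) x → MDiffAt (T% Y) x → MDiffAt (T% Z) x →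
      mvfderiv I (fun y => inner ℝ (Y y) (Z y)) x (X x) =
        inner ℝ (cov Y x (X x)) (Z x) + inner ℝ (Y x) (cov Z x (X x)) := by
  unfold IsMetric
  refine (CovariantDerivative.isMetricCompatible_iff (I := I) (F := E)
    (V := fun x : M => TangentSpace I x) _).trans ?_
  exact ⟨fun h x X Y Z => h, fun h x X Y Z => h x X Y Z⟩

/-- `(M, g, ∇)` is Einstein with skew-torsion (`∇`-Einstein): `∇` is a metric connection with
totally skew-symmetric torsion and `Sym(Ric^∇) = (s^∇ / dim M) g`. -/
structure IsEinsteinWithSkewTorsion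
    (cov : CovariantDerivative I E (TangentSpace I : M → Type _)) : Prop where
  metric : cov.IsMetric
  skewTorsion : cov.HasTotallySkewTorsion
  einstein : ∀ (x : M) (v w : TangentSpace I x),
    cov.symRicci x v w = cov.scalarCurvature x / (finrank ℝ E : ℝ) * inner ℝ v w

end CovariantDerivative

end General

/-! ### The round sphere `𝕊⁷ ⊂ ℂ⁴` -/

/-- `ℂ⁴ = ℝ⁸` with the Euclidean inner product `⟨z, w⟩ = Re ∑ zᵢ conj(wᵢ)`. -/
abbrev C4 : Type := EuclideanSpace ℂ (Fin 4)

instance finrankC4 : Fact (finrank ℝ C4 = 7 + 1) :=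
  ⟨by rw [← finrank_mul_finrank ℝ ℂ C4]; simp⟩

/-- The unit sphere of `ℂ⁴`. -/
abbrev S7 : Type := sphere (0 : C4) 1

namespace S7

/-- The inclusion `T_x 𝕊⁷ → ℂ⁴`: the differential of `𝕊⁷ ⊂ ℂ⁴`. -/
def incl (x : S7) : TangentSpace (𝓡 7) x →L[ℝ] C4 := mvfderiv (𝓡 7) ((↑) : S7 → C4) x

theorem incl_injective (x : S7) : Function.Injective (incl x) :=
  injective_mvfderiv_subtypeVal_sphere x

/-- The first fundamental form of `𝕊⁷ ⊂ ℂ⁴`. -/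
def metricForm (x : S7) : TangentSpace (𝓡 7) x →L[ℝ] TangentSpace (𝓡 7) x →L[ℝ] ℝ :=
  ContinuousLinearMap.precomp ℝ (incl x) ∘L innerSL ℝ ∘L incl x

theorem metricForm_apply (x : S7) (v w : TangentSpace (𝓡 7) x) :
    metricForm x v w = inner ℝ (incl x v) (incl x w) := rfl

theorem contMDiffAt_inclCoord (x₀ : S7) :
    ContMDiffAt (𝓡 7) 𝓘(ℝ, EuclideanSpace ℝ (Fin 7) →L[ℝ] C4) ∞
      (fun x => incl x ∘L
        (trivializationAt (EuclideanSpace ℝ (Fin 7)) (TangentSpace (𝓡 7)) x₀).symmL ℝ x) x₀ := by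
  have h := ContMDiffAt.mfderiv_const (m := ∞) (n := ∞) (I := 𝓡 7) (I' := 𝓘(ℝ, C4))
    (contMDiff_coe_sphere (E := C4) (n := 7) (m := ∞) x₀) (by simp)
  refine h.congr_of_eventuallyEq ?_
  refine Filter.Eventually.of_forall fun x => ?_
  ext v i
  simp [inTangentCoordinates, ContinuousLinearMap.inCoordinates, incl, mvfderiv]
  rfl

theorem metricForm_bounded (x : S7) :
    Bornology.IsVonNBounded ℝ {v : TangentSpace (𝓡 7) x | metricForm x v v < 1} := by
  let f : EuclideanSpace ℝ (Fin 7) →ₗ[ℝ] C4 := (incl x).toLinearMap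
  obtain ⟨K, hK, hf⟩ := f.exists_antilipschitzWith (LinearMap.ker_eq_bot.2 (incl_injective x))
  change Bornology.IsVonNBounded ℝ {v : EuclideanSpace ℝ (Fin 7) | inner ℝ (f v) (f v) < 1}
  rw [NormedSpace.isVonNBounded_iff, isBounded_iff_forall_norm_le]
  refine ⟨K, fun v hv => ?_⟩
  have h1 : ‖f v‖ ≤ 1 := by
    have : ‖f v‖ ^ 2 < 1 := by simpa [real_inner_self_eq_norm_sq] using hv
    nlinarith [norm_nonneg (f v)]
  have h2 : ‖v‖ ≤ K * ‖f v‖ := by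
    simpa using hf.le_mul_dist v 0
  calc ‖v‖ ≤ K * ‖f v‖ := h2
    _ ≤ K * 1 := by gcongr
    _ = K := mul_one _

theorem metricForm_smooth : ContMDiff (𝓡 7)
    ((𝓡 7).prod 𝓘(ℝ, EuclideanSpace ℝ (Fin 7) →L[ℝ] EuclideanSpace ℝ (Fin 7) →L[ℝ] ℝ)) ∞
    (fun b : S7 => TotalSpace.mk' (EuclideanSpace ℝ (Fin 7) →L[ℝ] EuclideanSpace ℝ (Fin 7) →L[ℝ] ℝ)
     (E := fun x : S7 => TangentSpace (𝓡 7) x →L[ℝ] TangentSpace (𝓡 7) x →L[ℝ] ℝ)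
     b (metricForm b)) := by
  intro x₀
  rw [contMDiffAt_section]
  have h := contMDiffAt_inclCoord x₀
  let B : (EuclideanSpace ℝ (Fin 7) →L[ℝ] C4) →
      (EuclideanSpace ℝ (Fin 7) →L[ℝ] EuclideanSpace ℝ (Fin 7) →L[ℝ] ℝ) :=
    fun L => ContinuousLinearMap.precomp ℝ L ∘L innerSL ℝ ∘L L
  have hB : ContDiff ℝ ∞ B := by
    have h1 : ContDiff ℝ ∞ (fun L : EuclideanSpace ℝ (Fin 7) →L[ℝ] C4 =>
      (ContinuousLinearMap.compL ℝ (EuclideanSpace ℝ (Fin 7)) C4 ℝ).flip L) := by fun_prop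
    have h2 : ContDiff ℝ ∞ (fun L : EuclideanSpace ℝ (Fin 7) →L[ℝ] C4 =>
      (innerSL ℝ : C4 →L[ℝ] C4 →L[ℝ] ℝ) ∘L L) := by fun_prop
    exact h1.clm_comp h2
  refine (hB.contMDiff.contMDiffAt.comp x₀ h).congr_of_eventuallyEq ?_
  have hs := (trivializationAt (EuclideanSpace ℝ (Fin 7)) (TangentSpace (𝓡 7))
    x₀).open_baseSet.mem_nhds (FiberBundle.mem_baseSet_trivializationAt _ _ x₀)
  filter_upwards [hs] with x hx
  have hx' : x ∈ (trivializationAt (EuclideanSpace ℝ (Fin 7) →L[ℝ] ℝ)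
      (fun x : S7 => TangentSpace (𝓡 7) x →L[ℝ] ℝ) x₀).baseSet := by
    rw [hom_trivializationAt_baseSet]
    exact ⟨hx, by simp⟩
  ext v w
  simp only [hom_trivializationAt_apply, ContinuousLinearMap.inCoordinates,
    ContinuousLinearMap.comp_apply, Trivialization.continuousLinearMapAt_apply,
    Trivialization.linearMapAt_apply, if_pos hx']
  simp [B, metricForm]

/-- The canonical metric `g` of constant curvature `1`, induced by `𝕊⁷ ⊂ ℂ⁴`. -/
def roundMetric : ContMDiffRiemannianMetric (𝓡 7) ∞ (EuclideanSpace ℝ (Fin 7))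
    (fun x : S7 => TangentSpace (𝓡 7) x) where
  inner := metricForm
  symm x v w := by simp only [metricForm_apply, real_inner_comm]
  pos x v hv := by
    rw [metricForm_apply]
    exact real_inner_self_pos.2 fun h => hv (incl_injective x (h.trans (map_zero _).symm))
  isVonNBounded := metricForm_bounded
  contMDiff := metricForm_smooth

instance : RiemannianBundle (fun x : S7 => TangentSpace (𝓡 7) x) :=
  ⟨roundMetric.toRiemannianMetric⟩

theorem inner_eq (x : S7) (v w : TangentSpace (𝓡 7) x) :
    inner ℝ v w = inner ℝ (incl x v) (incl x w) := rfl

instance (x : S7) : CompleteSpace (TangentSpace (𝓡 7) x) := FiniteDimensional.complete ℝ _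

/-- The orthogonal projection `ℂ⁴ → T_x 𝕊⁷` (tangent component), as the adjoint of the isometric
inclusion. -/
def tangentPart (x : S7) : C4 →L[ℝ] TangentSpace (𝓡 7) x := ContinuousLinearMap.adjoint (incl x)

theorem tangentPart_incl (x : S7) (v : TangentSpace (𝓡 7) x) : tangentPart x (incl x v) = v := by
  refine ext_inner_right ℝ fun w => ?_
  rw [tangentPart, ContinuousLinearMap.adjoint_inner_left, inner_eq]

theorem inner_tangentPart (x : S7) (a : C4) (v : TangentSpace (𝓡 7) x) :
    inner ℝ (tangentPart x a) v = inner ℝ a (incl x v) :=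
  ContinuousLinearMap.adjoint_inner_left _ _ _

/-- A vector field on `𝕊⁷` seen as a map `𝕊⁷ → ℂ⁴`. -/
def ambient (Y : Π x : S7, TangentSpace (𝓡 7) x) (x : S7) : C4 := incl x (Y x)

theorem mdifferentiableAt_ambient {Y : Π x : S7, TangentSpace (𝓡 7) x} {x : S7}
    (hY : MDifferentiableAt (𝓡 7) ((𝓡 7).prod 𝓘(ℝ, EuclideanSpace ℝ (Fin 7)))
      (fun y => TotalSpace.mk' (EuclideanSpace ℝ (Fin 7)) y (Y y)) x) :
    MDifferentiableAt (𝓡 7) 𝓘(ℝ, C4) (ambient Y) x := by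
  have h := (contMDiffAt_inclCoord x).mdifferentiableAt (by simp)
  have h2 := (mdifferentiableAt_section (IB := 𝓡 7) (F := EuclideanSpace ℝ (Fin 7)) Y).1 hY
  refine (h.clm_apply h2).congr_of_eventuallyEq ?_
  have hs := (trivializationAt (EuclideanSpace ℝ (Fin 7)) (TangentSpace (𝓡 7))
    x).open_baseSet.mem_nhds (FiberBundle.mem_baseSet_trivializationAt _ _ x)
  filter_upwards [hs] with y hy
  simp only [ContinuousLinearMap.comp_apply, ambient]
  have h3 : Trivialization.linearMapAt ℝ (trivializationAt (EuclideanSpace ℝ (Fin 7))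
      (TangentSpace (𝓡 7)) x) y (Y y) = (trivializationAt (EuclideanSpace ℝ (Fin 7))
      (TangentSpace (𝓡 7)) x ⟨y, Y y⟩).2 := by
    rw [Trivialization.coe_linearMapAt_of_mem _ hy]
  refine congrArg (incl y) ?_
  rw [← h3]
  exact ((trivializationAt (EuclideanSpace ℝ (Fin 7)) (TangentSpace (𝓡 7))
    x).symmL_continuousLinearMapAt (R := ℝ) hy (Y y)).symm

/-- The Levi-Civita connection `∇^g` of the round metric: `∇^g_X Y` is the tangential part of the
derivative of `Y : 𝕊⁷ → ℂ⁴` along `X`. -/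
def leviCivita : CovariantDerivative (𝓡 7) (EuclideanSpace ℝ (Fin 7))
    (fun x : S7 => TangentSpace (𝓡 7) x) where
  toFun Y x := tangentPart x ∘L mvfderiv (𝓡 7) (ambient Y) x
  isCovariantDerivativeOnUniv := by
    refine ⟨fun {Y Y' x} hY hY' _ => ?_, fun {Y f x} hY hf _ => ?_⟩
    · have : ambient (Y + Y') = ambient Y + ambient Y' := by
        ext1 y; exact map_add (incl y) _ _
      rw [this, mvfderiv_add (mdifferentiableAt_ambient hY) (mdifferentiableAt_ambient hY'),
        ContinuousLinearMap.comp_add]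
    · have : ambient (f • Y) = f • ambient Y := by
        ext1 y; exact map_smul (incl y) _ _
      rw [this, mvfderiv_smul hf (mdifferentiableAt_ambient hY), ContinuousLinearMap.comp_add]
      congr 1
      · ext1 v; exact map_smul (tangentPart x) _ _
      · ext1 v
        refine (map_smul (tangentPart x) _ _).trans ?_
        exact congrArg _ (tangentPart_incl x (Y x))

theorem leviCivita_apply (Y : Π x : S7, TangentSpace (𝓡 7) x) (x : S7)
    (u : TangentSpace (𝓡 7) x) :
    leviCivita Y x u = tangentPart x (mvfderiv (𝓡 7) (ambient Y) x u) := rfl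

theorem isMetric_leviCivita : leviCivita.IsMetric := by
  rw [CovariantDerivative.isMetric_iff]
  intro x X Y Z _ hY hZ
  have hY' := mdifferentiableAt_ambient hY
  have hZ' := mdifferentiableAt_ambient hZ
  rw [leviCivita_apply, leviCivita_apply, inner_tangentPart, real_inner_comm _ (Y x),
    inner_tangentPart]
  have h : (fun y => inner ℝ (Y y) (Z y)) = fun y => inner ℝ (ambient Y y) (ambient Z y) := rfl
  rw [h]
  rw [mvfderiv_inner hY' hZ', ambient, ambient, real_inner_comm (incl x (Y x)),
    real_inner_comm (incl x (Z x))]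

theorem fderiv_comp_extChartAt_symm {F : Type*} [NormedAddCommGroup F] [NormedSpace ℝ F]
    (x : S7) (X : Π x : S7, TangentSpace (𝓡 7) x) (h : S7 → F) (z : EuclideanSpace ℝ (Fin 7))
    (hz : z ∈ (extChartAt (𝓡 7) x).target)
    (hh : MDifferentiableAt (𝓡 7) 𝓘(ℝ, F) h ((extChartAt (𝓡 7) x).symm z)) :
    fderiv ℝ (h ∘ (extChartAt (𝓡 7) x).symm) z
        (mpullbackWithin 𝓘(ℝ, EuclideanSpace ℝ (Fin 7)) (𝓡 7) (extChartAt (𝓡 7) x).symm X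
          (Set.range (𝓡 7)) z) =
      mvfderiv (𝓡 7) h ((extChartAt (𝓡 7) x).symm z) (X ((extChartAt (𝓡 7) x).symm z)) := by
  have hi := isInvertible_mfderivWithin_extChartAt_symm (I := 𝓡 7) hz
  have hd := (mdifferentiableOn_extChartAt_symm (I := 𝓡 7) (x := x) z hz).mdifferentiableAt
    ((isOpen_extChartAt_target x).mem_nhds hz)
  have hc := (hh.hasMFDerivAt.comp z hd.hasMFDerivAt)
  have hc' := hc.mfderiv
  rw [mfderiv_eq_fderiv] at hc'
  rw [hc']
  rw [mpullbackWithin_apply]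
  have hr : Set.range (𝓡 7) = Set.univ := by simp
  rw [hr, mfderivWithin_univ] at hi ⊢
  refine congrArg (mfderiv (𝓡 7) 𝓘(ℝ, F) h _) ?_
  exact hi.self_apply_inverse _

theorem incl_mlieBracket {X Y : Π x : S7, TangentSpace (𝓡 7) x} {x : S7}
    (hX : MDifferentiableAt (𝓡 7) ((𝓡 7).prod 𝓘(ℝ, EuclideanSpace ℝ (Fin 7)))
      (fun y => TotalSpace.mk' (EuclideanSpace ℝ (Fin 7)) y (X y)) x)
    (hY : MDifferentiableAt (𝓡 7) ((𝓡 7).prod 𝓘(ℝ, EuclideanSpace ℝ (Fin 7)))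
      (fun y => TotalSpace.mk' (EuclideanSpace ℝ (Fin 7)) y (Y y)) x) :
    incl x (mlieBracket (𝓡 7) X Y x) =
      mvfderiv (𝓡 7) (ambient Y) x (X x) - mvfderiv (𝓡 7) (ambient X) x (Y x) := by
  have hr : Set.range (𝓡 7) = Set.univ := by simp
  have hX' := mdifferentiableAt_ambient hX
  have hY' := mdifferentiableAt_ambient hY
  set φ := extChartAt (𝓡 7) x with hφ
  have hx : φ.symm (φ x) = x := extChartAt_to_inv x
  have hcoe : ∀ y : S7, MDifferentiableAt (𝓡 7) 𝓘(ℝ, C4) ((↑) : S7 → C4) y := fun y =>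
    (contMDiff_coe_sphere (E := C4) (n := 7) (m := 1) y).mdifferentiableAt one_ne_zero
  set X' := mpullbackWithin 𝓘(ℝ, EuclideanSpace ℝ (Fin 7)) (𝓡 7) φ.symm X Set.univ with hX'd
  set Y' := mpullbackWithin 𝓘(ℝ, EuclideanSpace ℝ (Fin 7)) (𝓡 7) φ.symm Y Set.univ with hY'd
  have hdX : DifferentiableAt ℝ X' (φ x) := by
    have h :=
      (mdifferentiableWithinAt_univ.2 hX).differentiableWithinAt_mpullbackWithin_vectorField
    rw [hr, Set.preimage_univ, Set.univ_inter] at h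
    exact differentiableWithinAt_univ.1 h
  have hdY : DifferentiableAt ℝ Y' (φ x) := by
    have h :=
      (mdifferentiableWithinAt_univ.2 hY).differentiableWithinAt_mpullbackWithin_vectorField
    rw [hr, Set.preimage_univ, Set.univ_inter] at h
    exact differentiableWithinAt_univ.1 h
  have hF : ContDiffAt ℝ 2 (((↑) : S7 → C4) ∘ φ.symm) (φ x) := by
    have h1 := (contMDiffOn_extChartAt_symm (I := 𝓡 7) (n := 2) x).contMDiffAt
      (extChartAt_target_mem_nhds (I := 𝓡 7) x)
    have h2 := (contMDiff_coe_sphere (E := C4) (n := 7) (m := 2) (φ.symm (φ x))).comp (φ x) h1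
    exact h2.contDiffAt
  have key := fderiv_apply_lieBracket hF (by simp) hdY hdX
  have ev : ∀ Z : Π x : S7, TangentSpace (𝓡 7) x,
      (fun z => fderiv ℝ (((↑) : S7 → C4) ∘ φ.symm) z
        (mpullbackWithin 𝓘(ℝ, EuclideanSpace ℝ (Fin 7)) (𝓡 7) φ.symm Z Set.univ z)) =ᶠ[𝓝 (φ x)]
        ambient Z ∘ φ.symm := by
    intro Z
    filter_upwards [extChartAt_target_mem_nhds (I := 𝓡 7) x] with z hz
    have := fderiv_comp_extChartAt_symm x Z ((↑) : S7 → C4) z hz (hcoe _)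
    rw [hr] at this
    exact this
  rw [(ev Y).fderiv_eq, (ev X).fderiv_eq] at key
  have e1 := fderiv_comp_extChartAt_symm x X (ambient Y) (φ x) (mem_extChartAt_target x)
    (by rw [hx]; exact hY')
  have e2 := fderiv_comp_extChartAt_symm x Y (ambient X) (φ x) (mem_extChartAt_target x)
    (by rw [hx]; exact hX')
  rw [hr] at e1 e2
  rw [e1, e2, hx] at key
  have hbr : mlieBracket (𝓡 7) X Y x =
      (mfderiv (𝓡 7) 𝓘(ℝ, EuclideanSpace ℝ (Fin 7)) φ x).inverse
        (lieBracket ℝ X' Y' (φ x)) := by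
    rw [← mlieBracketWithin_univ, mlieBracketWithin_apply, hr, Set.preimage_univ, Set.univ_inter]
    exact congrArg _ (congrFun lieBracketWithin_univ _)
  rw [← key, hbr]
  have hdφ := mdifferentiableAt_extChartAt (I := 𝓡 7) (mem_chart_source (EuclideanSpace ℝ (Fin 7)) x)
  have hFd : MDifferentiableAt 𝓘(ℝ, EuclideanSpace ℝ (Fin 7)) 𝓘(ℝ, C4)
    (((↑) : S7 → C4) ∘ φ.symm) (φ x) := (hF.differentiableAt (by simp)).mdifferentiableAt
  have hcomp := (hFd.hasMFDerivAt.comp x hdφ.hasMFDerivAt).congr_of_eventuallyEq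
    (f₁ := ((↑) : S7 → C4)) (by
      filter_upwards [extChartAt_source_mem_nhds (I := 𝓡 7) x] with y hy
      exact congrArg _ (φ.left_inv hy).symm)
  have hi := isInvertible_mfderiv_extChartAt (I := 𝓡 7) (mem_extChartAt_source (I := 𝓡 7) x)
  have e3 : incl x = (fderiv ℝ (((↑) : S7 → C4) ∘ φ.symm) (φ x)) ∘L
      (mfderiv (𝓡 7) 𝓘(ℝ, EuclideanSpace ℝ (Fin 7)) φ x) := by
    rw [← mfderiv_eq_fderiv]
    exact hcomp.mfderiv
  rw [e3]
  exact congrArg (fderiv ℝ (((↑) : S7 → C4) ∘ φ.symm) (φ x)) (hi.self_apply_inverse _)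

theorem torsion_leviCivita : leviCivita.torsion = 0 := by
  rw [CovariantDerivative.torsion_eq_zero_iff]
  intro X Y x hX hY
  rw [leviCivita_apply, leviCivita_apply, ← map_sub, ← incl_mlieBracket hX hY, tangentPart_incl]

/-! ### The quaternionic structure `ℂ⁴ = ℍ²` and the induced tensors on `𝕊⁷`

`(z₀, z₁, z₂, z₃) ∈ ℂ⁴` is identified with `(z₀ + z₁ j, z₂ + z₃ j) ∈ ℍ²`, and `i`, `j`, `k` act by
left multiplication. -/

/-- Multiplication by `i` on `ℂ⁴`. -/
def quatI : C4 →ₗ[ℝ] C4 where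
  toFun z := Complex.I • z
  map_add' := smul_add _
  map_smul' c z := smul_comm _ _ _

/-- Left multiplication by `j` on `ℂ⁴ = ℍ²`. -/
def quatJ : C4 →ₗ[ℝ] C4 where
  toFun z := !₂[-conj (z 1), conj (z 0), -conj (z 3), conj (z 2)]
  map_add' z w := by ext a; fin_cases a <;> simp <;> ring
  map_smul' _ _ := by ext a; fin_cases a <;> simp

/-- Left multiplication by `k = i j` on `ℂ⁴ = ℍ²`. -/
def quatK : C4 →ₗ[ℝ] C4 := quatI ∘ₗ quatJ

section Tensors

variable (J : C4 →ₗ[ℝ] C4) (x : S7)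

/-- The vector field `ξ = -J N`, where `N` is the unit outward normal, `N_x = x`. -/
def xi : TangentSpace (𝓡 7) x := tangentPart x (-J x)

/-- `ψ(u)`: the tangential part of `J u`. -/
def psi : TangentSpace (𝓡 7) x →ₗ[ℝ] TangentSpace (𝓡 7) x :=
  (tangentPart x : C4 →ₗ[ℝ] TangentSpace (𝓡 7) x) ∘ₗ J ∘ₗ
    (incl x : TangentSpace (𝓡 7) x →ₗ[ℝ] C4)

/-- `η(u)`: the normal part of `J u`, so that `J u = ψ(u) + η(u) N`. -/
def eta (u : TangentSpace (𝓡 7) x) : ℝ := inner ℝ (J (incl x u)) (x : C4)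

/-- `Φ(u, v) = g(u, ψ(v))`. -/
def Phi (u v : TangentSpace (𝓡 7) x) : ℝ := inner ℝ u (psi J x v)

/-- `(η ∧ Φ)(u, v, w)`. -/
def etaWedgePhi (u v w : TangentSpace (𝓡 7) x) : ℝ :=
  eta J x u * Phi J x v w + eta J x v * Phi J x w u + eta J x w * Phi J x u v

end Tensors

/-- The three-form `Ω = η₂ ∧ Φ₂ - η₃ ∧ Φ₃`. -/
def Omega (x : S7) (u v w : TangentSpace (𝓡 7) x) : ℝ :=
  etaWedgePhi quatJ x u v w - etaWedgePhi quatK x u v w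

/-- `Θ`, determined by `g(Θ(u, v), w) = Ω(u, v, w)`. -/
def Theta (x : S7) (u v : TangentSpace (𝓡 7) x) : TangentSpace (𝓡 7) x :=
  let e := stdOrthonormalBasis ℝ (TangentSpace (𝓡 7) x)
  ∑ i, Omega x u v (e i) • e i

/-- `Θ̃`, determined by `g(Θ̃(u, v), w) = Ω(u, v, ψ₁(w))`. -/
def ThetaTilde (x : S7) (u v : TangentSpace (𝓡 7) x) : TangentSpace (𝓡 7) x :=
  let e := stdOrthonormalBasis ℝ (TangentSpace (𝓡 7) x)
  ∑ i, Omega x u v (psi quatI x (e i)) • e i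

section Linearity

variable (J : C4 →ₗ[ℝ] C4) (x : S7) (c : ℝ) (u u' v v' w w' : TangentSpace (𝓡 7) x)

theorem eta_add : eta J x (u + u') = eta J x u + eta J x u' := by
  simp [eta, inner_add_left]

theorem eta_smul : eta J x (c • u) = c * eta J x u := by
  simp [eta, inner_smul_left]

theorem Phi_add_left : Phi J x (u + u') v = Phi J x u v + Phi J x u' v := inner_add_left _ _ _

theorem Phi_add_right : Phi J x u (v + v') = Phi J x u v + Phi J x u v' := by
  simp [Phi, inner_add_right]

theorem Phi_smul_left : Phi J x (c • u) v = c * Phi J x u v := real_inner_smul_left _ _ _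

theorem Phi_smul_right : Phi J x u (c • v) = c * Phi J x u v := by
  simp [Phi, real_inner_smul_right]

theorem Omega_add_left : Omega x (u + u') v w = Omega x u v w + Omega x u' v w := by
  simp only [Omega, etaWedgePhi, eta_add, Phi_add_left, Phi_add_right]; ring

theorem Omega_add_mid : Omega x u (v + v') w = Omega x u v w + Omega x u v' w := by
  simp only [Omega, etaWedgePhi, eta_add, Phi_add_left, Phi_add_right]; ring

theorem Omega_add_right : Omega x u v (w + w') = Omega x u v w + Omega x u v w' := by
  simp only [Omega, etaWedgePhi, eta_add, Phi_add_left, Phi_add_right]; ring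

theorem Omega_smul_left : Omega x (c • u) v w = c * Omega x u v w := by
  simp only [Omega, etaWedgePhi, eta_smul, Phi_smul_left, Phi_smul_right]; ring

theorem Omega_smul_mid : Omega x u (c • v) w = c * Omega x u v w := by
  simp only [Omega, etaWedgePhi, eta_smul, Phi_smul_left, Phi_smul_right]; ring

theorem Omega_smul_right : Omega x u v (c • w) = c * Omega x u v w := by
  simp only [Omega, etaWedgePhi, eta_smul, Phi_smul_left, Phi_smul_right]; ring

/-- The tensor `∇ - ∇^g`. -/
def skewDiff (r : ℝ) (q : ℂ) (x : S7) (u v : TangentSpace (𝓡 7) x) : TangentSpace (𝓡 7) x :=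
  r • (Phi quatI x u v • xi quatI x - eta quatI x u • psi quatI x v
      + eta quatI x v • psi quatI x u)
    + q.re • Theta x u v + q.im • ThetaTilde x u v

end Linearity

theorem inner_Theta (x : S7) (u v w : TangentSpace (𝓡 7) x) :
    inner ℝ (Theta x u v) w = Omega x u v w := by
  let L : TangentSpace (𝓡 7) x →ₗ[ℝ] ℝ :=
    ⟨⟨Omega x u v, Omega_add_right x u v⟩, fun c w => Omega_smul_right x c u v w⟩
  have h := congrArg L ((stdOrthonormalBasis ℝ (TangentSpace (𝓡 7) x)).sum_repr' w)
  rw [map_sum] at h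
  refine Eq.trans ?_ h
  simp only [Theta, sum_inner, real_inner_smul_left, map_smul, smul_eq_mul]
  exact Finset.sum_congr rfl fun i _ => mul_comm _ _

theorem inner_ThetaTilde (x : S7) (u v w : TangentSpace (𝓡 7) x) :
    inner ℝ (ThetaTilde x u v) w = Omega x u v (psi quatI x w) := by
  let L : TangentSpace (𝓡 7) x →ₗ[ℝ] ℝ :=
    ⟨⟨Omega x u v, Omega_add_right x u v⟩, fun c w => Omega_smul_right x c u v w⟩
  have h := congrArg (L ∘ₗ psi quatI x)
    ((stdOrthonormalBasis ℝ (TangentSpace (𝓡 7) x)).sum_repr' w)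
  rw [map_sum] at h
  refine Eq.trans ?_ h
  simp only [ThetaTilde, sum_inner, real_inner_smul_left, map_smul, smul_eq_mul]
  exact Finset.sum_congr rfl fun i _ => mul_comm _ _

/-- `skewDiff r q x` as a bilinear map, with the arguments in the order of Mathlib's covariant
derivatives: `v ↦ u ↦ skewDiff r q x u v`. -/
def skewDiffBilin (r : ℝ) (q : ℂ) (x : S7) :
    TangentSpace (𝓡 7) x →ₗ[ℝ] TangentSpace (𝓡 7) x →ₗ[ℝ] TangentSpace (𝓡 7) x :=
  LinearMap.mk₂ ℝ (fun v u => skewDiff r q x u v)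
    (fun v v' u => by
      simp only [skewDiff, Theta, ThetaTilde, Phi_add_right, eta_add, map_add, Omega_add_mid,
        add_smul, Finset.sum_add_distrib]
      module)
    (fun c v u => by
      simp only [skewDiff, Theta, ThetaTilde, Phi_smul_right, eta_smul, map_smul, Omega_smul_mid,
        mul_smul, ← Finset.smul_sum]
      module)
    (fun v u u' => by
      simp only [skewDiff, Theta, ThetaTilde, Phi_add_left, eta_add, map_add, Omega_add_left,
        add_smul, Finset.sum_add_distrib]
      module)
    (fun c v u => by
      simp only [skewDiff, Theta, ThetaTilde, Phi_smul_left, eta_smul, map_smul, Omega_smul_left,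
        mul_smul, ← Finset.smul_sum]
      module)

/-- The connection
`∇_X Y = ∇^g_X Y + r (Φ₁(X, Y) ξ₁ - η₁(X) ψ₁(Y) + η₁(Y) ψ₁(X)) + Re(q) Θ(X, Y) + Im(q) Θ̃(X, Y)`. -/
def skewConnection (r : ℝ) (q : ℂ) : CovariantDerivative (𝓡 7) (EuclideanSpace ℝ (Fin 7))
    (fun x : S7 => TangentSpace (𝓡 7) x) :=
  leviCivita.addOneForm fun x => (skewDiffBilin r q x).toContinuousBilinearMap

theorem skewConnection_apply (r : ℝ) (q : ℂ) (Y : Π x : S7, TangentSpace (𝓡 7) x) (x : S7)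
    (u : TangentSpace (𝓡 7) x) :
    skewConnection r q Y x u = leviCivita Y x u + skewDiff r q x u (Y x) := rfl

end S7

end

namespace S7

/-! ### The quaternionic units -/

/-! Everything is computed in ℂ⁴. Write A_u v for the difference ∇_u v - ∇^g_u v. At a point x it is
T(x, u, v), where T (`ambientDiff`) is a trilinear map with constant coefficients, and ⟨T(x, u, v),
w⟩ is a 4-form on ℝ⁸ built from products of the 2-forms ⟨J_s ·, ·⟩. This is the content of
`incl_skewDiff`. Skewness of T makes every A_u a skew endomorphism, so ∇ is metric, and gives
torsion 2A, whose lowering is a 3-form; both hold for all r and q.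

Since T is constant, differentiating A only replaces the position x by the direction of
differentiation. Hence (`inner_curvature`), for tangent vectors, R(u, v)w = ⟨v, w⟩u - ⟨u, w⟩v +
2T(u, v, w) + A_u A_v w - A_v A_u w, up to normal terms. Taking the trace over u kills 2T and A_u
A_v w by skewness and leaves Ric(v, w) = 6⟨v, w⟩ - ∑ ⟨A_v e, A_w e⟩, which is already symmetric. The
sum is evaluated in `sum_inner_ambientDiff` by writing A_v as a combination of J₁, J₂, J₃ plus
rank-one maps, whose mutual traces are explicit.

The scalar curvature follows because η₁ has norm 1, and the Einstein equation holds exactly when the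
coefficient of η₁ ⊗ η₁ vanishes, that is, when |q|² = r². -/

theorem quatI_quatI (a : C4) : quatI (quatI a) = -a := by
  ext i
  simp [quatI, ← mul_assoc]

theorem quatJ_quatJ (a : C4) : quatJ (quatJ a) = -a := by
  ext i; fin_cases i <;> simp [quatJ]

theorem quatI_quatJ (a : C4) : quatI (quatJ a) = quatK a := rfl

theorem quatJ_quatI (a : C4) : quatJ (quatI a) = -quatK a := by
  ext i; fin_cases i <;> simp [quatJ, quatI, quatK]

theorem quatI_quatK (a : C4) : quatI (quatK a) = -quatJ a := by
  rw [← quatI_quatJ, quatI_quatI]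

theorem quatK_quatI (a : C4) : quatK (quatI a) = quatJ a := by
  rw [← quatI_quatJ, quatJ_quatI, map_neg, quatI_quatK, neg_neg]

theorem quatJ_quatK (a : C4) : quatJ (quatK a) = quatI a := by
  rw [← quatI_quatJ, quatJ_quatI, ← quatI_quatJ, quatJ_quatJ, map_neg, neg_neg]

theorem quatK_quatJ (a : C4) : quatK (quatJ a) = -quatI a := by
  rw [← quatI_quatJ, quatJ_quatJ, map_neg]

theorem quatK_quatK (a : C4) : quatK (quatK a) = -a := by
  rw [← quatI_quatJ (quatK a), quatJ_quatK, quatI_quatI]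

theorem inner_quatI_left (a b : C4) : inner ℝ (quatI a) b = -inner ℝ a (quatI b) := by
  simp [PiLp.inner_apply, Fin.sum_univ_four, Complex.inner, quatI]
  ring

theorem inner_quatJ_left (a b : C4) : inner ℝ (quatJ a) b = -inner ℝ a (quatJ b) := by
  simp [PiLp.inner_apply, Fin.sum_univ_four, Complex.inner, quatJ]
  ring

theorem inner_quatK_left (a b : C4) : inner ℝ (quatK a) b = -inner ℝ a (quatK b) := by
  rw [← quatI_quatJ, inner_quatI_left, inner_quatJ_left, quatJ_quatI, inner_neg_right, neg_neg]

theorem inner_right_quatI (a b : C4) : inner ℝ a (quatI b) = -inner ℝ (quatI a) b := by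
  rw [inner_quatI_left, neg_neg]

theorem inner_right_quatJ (a b : C4) : inner ℝ a (quatJ b) = -inner ℝ (quatJ a) b := by
  rw [inner_quatJ_left, neg_neg]

theorem inner_right_quatK (a b : C4) : inner ℝ a (quatK b) = -inner ℝ (quatK a) b := by
  rw [inner_quatK_left, neg_neg]

theorem inner_quatI_swap (a b : C4) : inner ℝ (quatI a) b = -inner ℝ (quatI b) a := by
  rw [inner_quatI_left, real_inner_comm]

theorem inner_quatJ_swap (a b : C4) : inner ℝ (quatJ a) b = -inner ℝ (quatJ b) a := by
  rw [inner_quatJ_left, real_inner_comm]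

theorem inner_quatK_swap (a b : C4) : inner ℝ (quatK a) b = -inner ℝ (quatK b) a := by
  rw [inner_quatK_left, real_inner_comm]

theorem inner_quatI_self (a : C4) : inner ℝ (quatI a) a = 0 := by
  linarith [inner_quatI_swap a a]

theorem inner_quatJ_self (a : C4) : inner ℝ (quatJ a) a = 0 := by
  linarith [inner_quatJ_swap a a]

theorem inner_quatK_self (a : C4) : inner ℝ (quatK a) a = 0 := by
  linarith [inner_quatK_swap a a]

/-! ### The ambient trilinear map of the connection -/

section WedgeMap

variable {V : Type*} [NormedAddCommGroup V] [InnerProductSpace ℝ V]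

/-- The trilinear map `(x, u, v) ↦ ⟨J x, u⟩ K v - ⟨J x, v⟩ K u + ⟨K u, v⟩ J x`. -/
noncomputable def wedgeMap (J K : V →L[ℝ] V) : V →L[ℝ] V →L[ℝ] V →L[ℝ] V :=
  (ContinuousLinearMap.smulRightL ℝ V (V →L[ℝ] V)).flip K ∘L innerSL ℝ ∘L J
    - ContinuousLinearMap.precomp (V →L[ℝ] V) K ∘L
        ContinuousLinearMap.smulRightL ℝ V V ∘L innerSL ℝ ∘L J
    + ContinuousLinearMap.precomp (V →L[ℝ] V) (innerSL ℝ ∘L K) ∘L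
        (ContinuousLinearMap.smulRightL ℝ V V).flip ∘L J

set_option synthInstance.maxHeartbeats 200000 in
/-- With `W_ab = wedgeMap J_a J_b`, the combination `r W₁₁ + s (W₂₂ - W₃₃) - t (W₂₃ + W₃₂)`. -/
noncomputable def wedgeCombination (J₁ J₂ J₃ : V →L[ℝ] V) (r s t : ℝ) :
    V →L[ℝ] V →L[ℝ] V →L[ℝ] V :=
  r • wedgeMap J₁ J₁ + s • (wedgeMap J₂ J₂ - wedgeMap J₃ J₃)
    - t • (wedgeMap J₂ J₃ + wedgeMap J₃ J₂)

end WedgeMap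

/-- The constant trilinear map on `ℂ⁴` that restricts to `∇ - ∇^g` on `𝕊⁷`, when its first
argument is the position vector. -/
noncomputable def ambientDiff (r : ℝ) (q : ℂ) : C4 →L[ℝ] C4 →L[ℝ] C4 →L[ℝ] C4 :=
  wedgeCombination quatI.toContinuousLinearMap quatJ.toContinuousLinearMap
    quatK.toContinuousLinearMap r q.re q.im

theorem ambientDiff_apply (r : ℝ) (q : ℂ) (x u v : C4) :
    ambientDiff r q x u v =
      r • ((inner ℝ (quatI x) u : ℝ) • quatI v - (inner ℝ (quatI x) v : ℝ) • quatI u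
        + (inner ℝ (quatI u) v : ℝ) • quatI x)
      + q.re • (((inner ℝ (quatJ x) u : ℝ) • quatJ v - (inner ℝ (quatJ x) v : ℝ) • quatJ u
        + (inner ℝ (quatJ u) v : ℝ) • quatJ x)
        - ((inner ℝ (quatK x) u : ℝ) • quatK v - (inner ℝ (quatK x) v : ℝ) • quatK u
        + (inner ℝ (quatK u) v : ℝ) • quatK x))
      - q.im • (((inner ℝ (quatJ x) u : ℝ) • quatK v - (inner ℝ (quatJ x) v : ℝ) • quatK u
        + (inner ℝ (quatK u) v : ℝ) • quatJ x)
        + ((inner ℝ (quatK x) u : ℝ) • quatJ v - (inner ℝ (quatK x) v : ℝ) • quatJ u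
        + (inner ℝ (quatJ u) v : ℝ) • quatK x)) := rfl

/-- For W_ab with a = b this is the skewness of J_a. W₂₃ and W₃₂ do not have this symmetry
separately; only their sum does. Together with the next two lemmas it says that ⟨T(x, u, v), w⟩ is a
4-form. -/
theorem ambientDiff_swap_left (r : ℝ) (q : ℂ) (x u v : C4) :
    ambientDiff r q u x v = -ambientDiff r q x u v := by
  simp only [ambientDiff_apply]
  rw [inner_quatI_swap u x, inner_quatJ_swap u x, inner_quatK_swap u x]
  module

theorem ambientDiff_swap_right (r : ℝ) (q : ℂ) (x u v : C4) :
    ambientDiff r q x v u = -ambientDiff r q x u v := by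
  simp only [ambientDiff_apply]
  rw [inner_quatI_swap v u, inner_quatJ_swap v u, inner_quatK_swap v u]
  module

theorem inner_ambientDiff_swap (r : ℝ) (q : ℂ) (x u v w : C4) :
    inner ℝ (ambientDiff r q x u w) v = -inner ℝ (ambientDiff r q x u v) w := by
  simp only [ambientDiff_apply, inner_add_left, inner_sub_left,
    real_inner_smul_left]
  rw [inner_quatI_swap w v, inner_quatJ_swap w v, inner_quatK_swap w v]
  ring

theorem eq_zero_of_eq_neg {a : C4} (h : a = -a) : a = 0 := by
  have h2 : (2 : ℝ) • a = 0 := by rw [two_smul]; nth_rewrite 2 [h]; exact add_neg_cancel a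
  exact (smul_eq_zero.1 h2).resolve_left two_ne_zero

theorem ambientDiff_self_right (r : ℝ) (q : ℂ) (x u : C4) : ambientDiff r q x u u = 0 :=
  eq_zero_of_eq_neg (ambientDiff_swap_right r q x u u)

theorem ambientDiff_self_left (r : ℝ) (q : ℂ) (x u : C4) : ambientDiff r q x x u = 0 :=
  eq_zero_of_eq_neg (ambientDiff_swap_left r q x x u)

theorem ambientDiff_self_outer (r : ℝ) (q : ℂ) (x u : C4) : ambientDiff r q x u x = 0 := by
  rw [ambientDiff_swap_right, ambientDiff_self_left, neg_zero]

theorem inner_ambientDiff_self_mid (r : ℝ) (q : ℂ) (x u v : C4) :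
    inner ℝ (ambientDiff r q x u v) u = 0 := by
  rw [inner_ambientDiff_swap, ambientDiff_self_right, inner_zero_left, neg_zero]

/-- Hence the values of the map are tangent to the sphere at its first argument. -/
theorem inner_ambientDiff_self_left (r : ℝ) (q : ℂ) (x u v : C4) :
    inner ℝ (ambientDiff r q x u v) x = 0 := by
  rw [inner_ambientDiff_swap, ambientDiff_self_outer, inner_zero_left, neg_zero]

/-! ### Tangent vectors of the sphere as vectors of `ℂ⁴` -/

theorem inner_incl_self (x : S7) (v : TangentSpace (𝓡 7) x) :
    inner ℝ (incl x v) (x : C4) = 0 := by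
  have h : incl x v ∈ (ℝ ∙ (x : C4))ᗮ := by
    rw [← range_mvfderiv_subtypeVal (n := 7) x]
    exact ⟨v, rfl⟩
  exact Submodule.inner_left_of_mem_orthogonal (Submodule.mem_span_singleton_self _) h

theorem inner_self_incl (x : S7) (v : TangentSpace (𝓡 7) x) :
    inner ℝ (x : C4) (incl x v) = 0 := by
  rw [real_inner_comm, inner_incl_self]

theorem inner_self_self (x : S7) : inner ℝ (x : C4) (x : C4) = (1 : ℝ) := by
  rw [real_inner_self_eq_norm_sq, norm_eq_of_mem_sphere]; norm_num

theorem exists_incl_eq (x : S7) {a : C4} (ha : inner ℝ a (x : C4) = (0 : ℝ)) :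
    ∃ v, incl x v = a := by
  have h : a ∈ (ℝ ∙ (x : C4))ᗮ := Submodule.mem_orthogonal_singleton_iff_inner_left.2 ha
  rw [← range_mvfderiv_subtypeVal (n := 7) x] at h
  exact h

theorem incl_tangentPart_of_inner_eq_zero (x : S7) {a : C4}
    (ha : inner ℝ a (x : C4) = (0 : ℝ)) : incl x (tangentPart x a) = a := by
  obtain ⟨v, rfl⟩ := exists_incl_eq x ha
  rw [tangentPart_incl]

/-- `tangentPart x` is defined as an adjoint; here it becomes the explicit projection along the unit
normal x. -/
theorem incl_tangentPart (x : S7) (a : C4) :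
    incl x (tangentPart x a) = a - (inner ℝ a (x : C4) : ℝ) • (x : C4) := by
  have h0 : tangentPart x (x : C4) = 0 := by
    refine ext_inner_right ℝ fun w => ?_
    rw [inner_tangentPart, inner_self_incl, inner_zero_left]
  have h1 : tangentPart x a = tangentPart x (a - (inner ℝ a (x : C4) : ℝ) • (x : C4)) := by
    rw [map_sub, map_smul, h0, smul_zero, sub_zero]
  rw [h1]
  refine incl_tangentPart_of_inner_eq_zero x ?_
  rw [inner_sub_left, real_inner_smul_left, inner_self_self]; ring

/-- Both sides are tangent, so it is enough to pair them with tangent vectors w. In Θ̃ the argument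
ψ₁(w) brings in J₂J₁ = -J₃ and J₃J₁ = J₂, which is where the mixed terms -(W₂₃ + W₃₂) come from. -/
theorem incl_skewDiff (r : ℝ) (q : ℂ) (x : S7) (u v : TangentSpace (𝓡 7) x) :
    incl x (skewDiff r q x u v) = ambientDiff r q x (incl x u) (incl x v) := by
  rw [← incl_tangentPart_of_inner_eq_zero x
    (inner_ambientDiff_self_left r q x (incl x u) (incl x v))]
  refine congrArg _ (ext_inner_right ℝ fun w => ?_)
  have hP : ∀ (a : TangentSpace (𝓡 7) x) (b : C4), inner ℝ a (tangentPart x b) =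
      inner ℝ (incl x a) b := fun a b => by
    rw [real_inner_comm, inner_tangentPart, real_inner_comm]
  rw [inner_tangentPart]
  simp only [skewDiff, inner_add_left, inner_sub_left, real_inner_smul_left, inner_Theta,
    inner_ThetaTilde, Omega, etaWedgePhi, eta, Phi, psi, xi, LinearMap.comp_apply,
    ContinuousLinearMap.coe_coe, inner_tangentPart, hP,
    ambientDiff_apply, inner_neg_left]
  -- The projection left is the one in ψ₁(w). Its normal correction contributes, for each of J₂ and
  -- J₃, products ⟨J_s x, u⟩⟨J_s x, v⟩ that cancel in pairs.
  rw [incl_tangentPart]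
  generalize incl x u = u'
  generalize incl x v = v'
  generalize incl x w = w'
  generalize (x : C4) = x'
  simp only [map_sub, map_smul, quatJ_quatI, quatK_quatI, inner_sub_left, inner_sub_right,
    inner_neg_left, inner_neg_right, real_inner_smul_left, real_inner_smul_right,
    inner_quatJ_self, inner_quatK_self,
    inner_right_quatI, inner_right_quatJ, inner_right_quatK]
  -- Fixing one order in each pair of vectors turns the claim into a polynomial identity in the
  -- remaining inner products.
  rw [inner_quatI_swap u' x', inner_quatI_swap v' x', inner_quatI_swap w' x',
    inner_quatJ_swap u' x', inner_quatJ_swap v' x', inner_quatJ_swap w' x',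
    inner_quatK_swap u' x', inner_quatK_swap v' x', inner_quatK_swap w' x',
    inner_quatJ_swap w' u', inner_quatK_swap w' u']
  ring

/-! ### Traces over the tangent space -/

theorem finrank_tangentSpace (x : S7) : finrank ℝ (TangentSpace (𝓡 7) x) = 7 :=
  finrank_euclideanSpace_fin (𝕜 := ℝ) (n := 7)

/-- Parseval for the tangential parts of a and b; the subtracted term is the missing normal
direction. -/
theorem sum_inner_mul_inner (x : S7) (a b : C4) :
    ∑ i, inner ℝ a (incl x (stdOrthonormalBasis ℝ (TangentSpace (𝓡 7) x) i)) *
        inner ℝ b (incl x (stdOrthonormalBasis ℝ (TangentSpace (𝓡 7) x) i)) =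
      inner ℝ a b - inner ℝ a (x : C4) * inner ℝ b (x : C4) := by
  have h := (stdOrthonormalBasis ℝ (TangentSpace (𝓡 7) x)).sum_inner_mul_inner
    (tangentPart x a) (tangentPart x b)
  rw [inner_tangentPart, incl_tangentPart, inner_sub_right, real_inner_smul_right] at h
  rw [mul_comm (inner ℝ a (x : C4) : ℝ), ← h]
  refine Finset.sum_congr rfl fun i _ => ?_
  rw [inner_tangentPart, real_inner_comm (tangentPart x b), inner_tangentPart]

theorem sum_inner_self (x : S7) :
    ∑ i, inner ℝ (incl x (stdOrthonormalBasis ℝ (TangentSpace (𝓡 7) x) i))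
      (incl x (stdOrthonormalBasis ℝ (TangentSpace (𝓡 7) x) i)) = (7 : ℝ) := by
  simp only [← inner_eq]
  simp [finrank_tangentSpace]

/-- `∑ ⟨f e, g e⟩` over an orthonormal basis of `T_x 𝕊⁷`. -/
noncomputable def traceInner (x : S7) : (C4 →ₗ[ℝ] C4) →ₗ[ℝ] (C4 →ₗ[ℝ] C4) →ₗ[ℝ] ℝ :=
  LinearMap.mk₂ ℝ (fun f g => ∑ i,
      inner ℝ (f (incl x (stdOrthonormalBasis ℝ (TangentSpace (𝓡 7) x) i)))
        (g (incl x (stdOrthonormalBasis ℝ (TangentSpace (𝓡 7) x) i))))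
    (fun f f' g => by simp only [LinearMap.add_apply, inner_add_left, Finset.sum_add_distrib])
    (fun c f g => by
      simp only [LinearMap.smul_apply, real_inner_smul_left, ← Finset.mul_sum, smul_eq_mul])
    (fun f g g' => by simp only [LinearMap.add_apply, inner_add_right, Finset.sum_add_distrib])
    (fun c f g => by
      simp only [LinearMap.smul_apply, real_inner_smul_right, ← Finset.mul_sum, smul_eq_mul])

theorem traceInner_apply (x : S7) (f g : C4 →ₗ[ℝ] C4) : traceInner x f g =
    ∑ i, inner ℝ (f (incl x (stdOrthonormalBasis ℝ (TangentSpace (𝓡 7) x) i)))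
      (g (incl x (stdOrthonormalBasis ℝ (TangentSpace (𝓡 7) x) i))) := rfl

theorem traceInner_comm (x : S7) (f g : C4 →ₗ[ℝ] C4) :
    traceInner x f g = traceInner x g f := by
  simp only [traceInner_apply, real_inner_comm]

/-- The linear map `e ↦ ⟨p, e⟩ b`. -/
noncomputable def rankOneMap (p b : C4) : C4 →ₗ[ℝ] C4 := (innerₗ C4 p).smulRight b

theorem rankOneMap_apply (p b e : C4) : rankOneMap p b e = (inner ℝ p e : ℝ) • b := rfl

theorem traceInner_rankOneMap_rankOneMap (x : S7) (p b q d : C4) :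
    traceInner x (rankOneMap p b) (rankOneMap q d) =
      (inner ℝ p q - inner ℝ p (x : C4) * inner ℝ q (x : C4)) * inner ℝ b d := by
  rw [traceInner_apply, ← sum_inner_mul_inner, Finset.sum_mul]
  refine Finset.sum_congr rfl fun i _ => ?_
  rw [rankOneMap_apply, rankOneMap_apply, real_inner_smul_left, real_inner_smul_right]
  ring

/-- Each summand is ⟨q, e⟩⟨J e, d⟩ = -⟨q, e⟩⟨J d, e⟩ by skewness, so Parseval applies. -/
theorem traceInner_rankOneMap_right (x : S7) {J : C4 →ₗ[ℝ] C4}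
    (hJ : ∀ a b : C4, inner ℝ (J a) b = -inner ℝ (J b) a) (q d : C4) :
    traceInner x J (rankOneMap q d) =
      -inner ℝ (J d) q + inner ℝ (J d) (x : C4) * inner ℝ q (x : C4) := by
  rw [← sub_neg_eq_add, ← neg_sub', ← sum_inner_mul_inner, traceInner_apply,
    ← Finset.sum_neg_distrib]
  refine Finset.sum_congr rfl fun i _ => ?_
  rw [rankOneMap_apply, real_inner_smul_right, hJ]
  ring

theorem traceInner_rankOneMap_left (x : S7) {J : C4 →ₗ[ℝ] C4}
    (hJ : ∀ a b : C4, inner ℝ (J a) b = -inner ℝ (J b) a) (q d : C4) :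
    traceInner x (rankOneMap q d) J =
      -inner ℝ (J d) q + inner ℝ (J d) (x : C4) * inner ℝ q (x : C4) := by
  rw [traceInner_comm, traceInner_rankOneMap_right x hJ]

/-! ### Mutual traces of the quaternionic units: each is an isometry, and products of distinct units
are skew. -/

theorem inner_quatI_quatI (a b : C4) : inner ℝ (quatI a) (quatI b) = inner ℝ a b := by
  rw [inner_quatI_left, quatI_quatI, inner_neg_right, neg_neg]

theorem inner_quatJ_quatJ (a b : C4) : inner ℝ (quatJ a) (quatJ b) = inner ℝ a b := by
  rw [inner_quatJ_left, quatJ_quatJ, inner_neg_right, neg_neg]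

theorem inner_quatK_quatK (a b : C4) : inner ℝ (quatK a) (quatK b) = inner ℝ a b := by
  rw [inner_quatK_left, quatK_quatK, inner_neg_right, neg_neg]

theorem inner_quatI_quatJ (a b : C4) : inner ℝ (quatI a) (quatJ b) = inner ℝ (quatK a) b := by
  rw [inner_quatI_left, quatI_quatJ, inner_quatK_left]

theorem inner_quatI_quatK (a b : C4) : inner ℝ (quatI a) (quatK b) = -inner ℝ (quatJ a) b := by
  rw [inner_quatI_left, quatI_quatK, inner_quatJ_left, inner_neg_right]

theorem inner_quatJ_quatK (a b : C4) : inner ℝ (quatJ a) (quatK b) = inner ℝ (quatI a) b := by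
  rw [inner_quatJ_left, quatJ_quatK, inner_quatI_left]

theorem traceInner_quatI_quatI (x : S7) : traceInner x quatI quatI = 7 := by
  simp only [traceInner_apply, inner_quatI_quatI, sum_inner_self]

theorem traceInner_quatJ_quatJ (x : S7) : traceInner x quatJ quatJ = 7 := by
  simp only [traceInner_apply, inner_quatJ_quatJ, sum_inner_self]

theorem traceInner_quatK_quatK (x : S7) : traceInner x quatK quatK = 7 := by
  simp only [traceInner_apply, inner_quatK_quatK, sum_inner_self]

theorem traceInner_quatI_quatJ (x : S7) : traceInner x quatI quatJ = 0 := by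
  simp only [traceInner_apply, inner_quatI_quatJ, inner_quatK_self, Finset.sum_const_zero]

theorem traceInner_quatI_quatK (x : S7) : traceInner x quatI quatK = 0 := by
  simp only [traceInner_apply, inner_quatI_quatK, inner_quatJ_self, neg_zero,
    Finset.sum_const_zero]

theorem traceInner_quatJ_quatK (x : S7) : traceInner x quatJ quatK = 0 := by
  simp only [traceInner_apply, inner_quatJ_quatK, inner_quatI_self, Finset.sum_const_zero]

theorem traceInner_quatJ_quatI (x : S7) : traceInner x quatJ quatI = 0 := by
  rw [traceInner_comm, traceInner_quatI_quatJ]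

theorem traceInner_quatK_quatI (x : S7) : traceInner x quatK quatI = 0 := by
  rw [traceInner_comm, traceInner_quatI_quatK]

theorem traceInner_quatK_quatJ (x : S7) : traceInner x quatK quatJ = 0 := by
  rw [traceInner_comm, traceInner_quatJ_quatK]

/-- In W_ab(x, v, e) the term ⟨J_a x, v⟩ J_b e is a multiple of a unit, while the other two terms
have rank one in e. Collecting the rank-one terms by target vector leaves six of them, so a trace of
two such maps needs only the formulas above. -/
theorem ambientDiff_eq_sum_rankOneMap (r : ℝ) (q : ℂ) (x v : C4) :
    (ambientDiff r q x v : C4 →ₗ[ℝ] C4) =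
      (r * inner ℝ (quatI x) v) • quatI
      + (q.re * inner ℝ (quatJ x) v - q.im * inner ℝ (quatK x) v) • quatJ
      + (-q.re * inner ℝ (quatK x) v - q.im * inner ℝ (quatJ x) v) • quatK
      + rankOneMap (-r • quatI x) (quatI v)
      + rankOneMap (q.im • quatK x - q.re • quatJ x) (quatJ v)
      + rankOneMap (q.re • quatK x + q.im • quatJ x) (quatK v)
      + rankOneMap (r • quatI v) (quatI x)
      + rankOneMap (q.re • quatJ v - q.im • quatK v) (quatJ x)
      + rankOneMap (-q.re • quatK v - q.im • quatJ v) (quatK x) := by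
  refine LinearMap.ext fun e => ?_
  simp only [ContinuousLinearMap.coe_coe, ambientDiff_apply, LinearMap.add_apply,
    LinearMap.smul_apply, rankOneMap_apply, inner_add_left, inner_sub_left, real_inner_smul_left]
  module

theorem sum_inner_ambientDiff (r : ℝ) (q : ℂ) (x : S7) (v w : TangentSpace (𝓡 7) x) :
    ∑ i, inner ℝ (ambientDiff r q x (incl x v)
          (incl x (stdOrthonormalBasis ℝ (TangentSpace (𝓡 7) x) i)))
        (ambientDiff r q x (incl x w)
          (incl x (stdOrthonormalBasis ℝ (TangentSpace (𝓡 7) x) i))) =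
      (2 * r ^ 2 + 4 * ‖q‖ ^ 2) * inner ℝ v w
        + 4 * (r ^ 2 - ‖q‖ ^ 2) * (eta quatI x v * eta quatI x w) := by
  have hq : ‖q‖ ^ 2 = q.re ^ 2 + q.im ^ 2 := by
    rw [Complex.sq_norm, Complex.normSq_apply]; ring
  rw [hq]
  refine (traceInner_apply x (ambientDiff r q x (incl x v) : C4 →ₗ[ℝ] C4)
    (ambientDiff r q x (incl x w) : C4 →ₗ[ℝ] C4)).symm.trans ?_
  rw [ambientDiff_eq_sum_rankOneMap, ambientDiff_eq_sum_rankOneMap, eta, eta, inner_eq]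
  simp only [map_add, LinearMap.add_apply, map_smul, LinearMap.smul_apply, smul_eq_mul,
    traceInner_quatI_quatI, traceInner_quatI_quatJ, traceInner_quatI_quatK,
    traceInner_quatJ_quatI, traceInner_quatJ_quatJ, traceInner_quatJ_quatK,
    traceInner_quatK_quatI, traceInner_quatK_quatJ, traceInner_quatK_quatK,
    traceInner_rankOneMap_rankOneMap, traceInner_rankOneMap_right x inner_quatI_swap,
    traceInner_rankOneMap_right x inner_quatJ_swap, traceInner_rankOneMap_right x inner_quatK_swap,
    traceInner_rankOneMap_left x inner_quatI_swap,
    traceInner_rankOneMap_left x inner_quatJ_swap, traceInner_rankOneMap_left x inner_quatK_swap]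
  have hx := inner_self_self x
  have hv := inner_incl_self x v
  have hw := inner_incl_self x w
  have hv' := inner_self_incl x v
  have hw' := inner_self_incl x w
  generalize incl x v = v' at *
  generalize incl x w = w' at *
  generalize (x : C4) = x' at *
  -- The quaternion relations and skewness bring every inner product to a normal form: ⟨v, w⟩, ⟨J_s
  -- v, w⟩, ⟨J_s x, v⟩ or ⟨J_s x, w⟩. The terms other than ⟨v, w⟩ and η₁(v)η₁(w) then cancel.
  simp only [inner_add_left, inner_sub_left, inner_add_right, inner_sub_right,
    real_inner_smul_left, real_inner_smul_right, inner_neg_left,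
    quatI_quatI, quatJ_quatI, quatK_quatI, quatI_quatJ, quatJ_quatJ, quatK_quatJ,
    quatI_quatK, quatJ_quatK, quatK_quatK,
    inner_right_quatI, inner_right_quatJ, inner_right_quatK,
    inner_quatI_self, inner_quatJ_self, inner_quatK_self,
    inner_quatI_swap v' x', inner_quatJ_swap v' x', inner_quatK_swap v' x',
    inner_quatI_swap w' x', inner_quatJ_swap w' x', inner_quatK_swap w' x',
    hx, hv, hw, hv', hw']
  ring

/-! ### Calculus on the sphere -/

theorem mvfderiv_bilinear {V W U : Type*} [NormedAddCommGroup V] [NormedSpace ℝ V]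
    [NormedAddCommGroup W] [NormedSpace ℝ W] [NormedAddCommGroup U] [NormedSpace ℝ U]
    (B : V →L[ℝ] W →L[ℝ] U) {F : S7 → V} {G : S7 → W} {x : S7}
    (hF : MDifferentiableAt (𝓡 7) 𝓘(ℝ, V) F x) (hG : MDifferentiableAt (𝓡 7) 𝓘(ℝ, W) G x)
    (u : TangentSpace (𝓡 7) x) :
    MDifferentiableAt (𝓡 7) 𝓘(ℝ, U) (fun y => B (F y) (G y)) x ∧
    mvfderiv (𝓡 7) (fun y => B (F y) (G y)) x u =
      B (mvfderiv (𝓡 7) F x u) (G x) + B (F x) (mvfderiv (𝓡 7) G x u) := by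
  have h1 := B.isBoundedBilinearMap.hasFDerivAt (F x, G x)
  have h0 : HasMFDerivAt (𝓡 7) 𝓘(ℝ, V × W) (fun y => (F y, G y)) x
      ((mvfderiv (𝓡 7) F x).prod (mvfderiv (𝓡 7) G x)) :=
    ⟨hF.hasMFDerivAt.1.prodMk hG.hasMFDerivAt.1, hF.hasMFDerivAt.2.prodMk hG.hasMFDerivAt.2⟩
  have h2 := HasMFDerivAt.comp x (g := fun p : V × W => B p.1 p.2) h1.hasMFDerivAt h0
  have h3 := congrArg (fun L => L u) h2.mfderiv
  exact ⟨h2.mdifferentiableAt, h3.trans (add_comm _ _)⟩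

theorem mvfderiv_trilinear (T : C4 →L[ℝ] C4 →L[ℝ] C4 →L[ℝ] C4) {P F G : S7 → C4} {x : S7}
    (hP : MDifferentiableAt (𝓡 7) 𝓘(ℝ, C4) P x)
    (hF : MDifferentiableAt (𝓡 7) 𝓘(ℝ, C4) F x) (hG : MDifferentiableAt (𝓡 7) 𝓘(ℝ, C4) G x)
    (u : TangentSpace (𝓡 7) x) :
    MDifferentiableAt (𝓡 7) 𝓘(ℝ, C4) (fun y => T (P y) (F y) (G y)) x ∧
    mvfderiv (𝓡 7) (fun y => T (P y) (F y) (G y)) x u =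
      T (mvfderiv (𝓡 7) P x u) (F x) (G x) + T (P x) (mvfderiv (𝓡 7) F x u) (G x)
        + T (P x) (F x) (mvfderiv (𝓡 7) G x u) := by
  have h1 := mvfderiv_bilinear T hP hF u
  -- The identity of C4 →L C4, read as a bilinear map, is evaluation (L, v) ↦ L v, so the bilinear
  -- rule can be used a second time.
  have h2 := mvfderiv_bilinear (ContinuousLinearMap.id ℝ (C4 →L[ℝ] C4)) h1.1 hG u
  exact ⟨h2.1, h2.2.trans (congrArg (fun L : C4 →L[ℝ] C4 =>
    L (G x) + T (P x) (F x) (mvfderiv (𝓡 7) G x u)) h1.2)⟩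

/-- Two derivatives are needed because curvature differentiates its last field twice. -/
theorem contMDiffAt_ambient {Y : Π x : S7, TangentSpace (𝓡 7) x} {x : S7}
    (hY : ContMDiffAt (𝓡 7) ((𝓡 7).prod 𝓘(ℝ, EuclideanSpace ℝ (Fin 7))) 2
      (fun y => TotalSpace.mk' (EuclideanSpace ℝ (Fin 7)) y (Y y)) x) :
    ContMDiffAt (𝓡 7) 𝓘(ℝ, C4) 2 (ambient Y) x := by
  have h := (contMDiffAt_inclCoord x).of_le (m := 2) (WithTop.coe_le_coe.2 le_top)
  have h2 := (contMDiffAt_section x).1 hY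
  refine (h.clm_apply h2).congr_of_eventuallyEq ?_
  have hs := (trivializationAt (EuclideanSpace ℝ (Fin 7)) (TangentSpace (𝓡 7))
    x).open_baseSet.mem_nhds (FiberBundle.mem_baseSet_trivializationAt _ _ x)
  filter_upwards [hs] with y hy
  simp only [ContinuousLinearMap.comp_apply, ambient]
  have h3 : Trivialization.linearMapAt ℝ (trivializationAt (EuclideanSpace ℝ (Fin 7))
      (TangentSpace (𝓡 7)) x) y (Y y) = (trivializationAt (EuclideanSpace ℝ (Fin 7))
      (TangentSpace (𝓡 7)) x ⟨y, Y y⟩).2 := by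
    rw [Trivialization.coe_linearMapAt_of_mem _ hy]
  refine congrArg (incl y) ?_
  rw [← h3]
  exact ((trivializationAt (EuclideanSpace ℝ (Fin 7)) (TangentSpace (𝓡 7))
    x).symmL_continuousLinearMapAt (R := ℝ) hy (Y y)).symm

/-- The derivative of `f` along `Y` in the chart at `x`. -/
theorem eventuallyEq_fderiv_mpullbackWithin {F : Type*} [NormedAddCommGroup F] [NormedSpace ℝ F]
    {f : S7 → F} {x : S7} (hf : ContMDiffAt (𝓡 7) 𝓘(ℝ, F) 2 f x)
    (Y : Π x : S7, TangentSpace (𝓡 7) x) :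
    (fun z => fderiv ℝ (f ∘ (extChartAt (𝓡 7) x).symm) z
        (mpullbackWithin 𝓘(ℝ, EuclideanSpace ℝ (Fin 7)) (𝓡 7) (extChartAt (𝓡 7) x).symm Y
          (Set.range (𝓡 7)) z)) =ᶠ[𝓝 (extChartAt (𝓡 7) x x)]
      (fun y => mvfderiv (𝓡 7) f y (Y y)) ∘ (extChartAt (𝓡 7) x).symm := by
  -- Being C² at a point is an open condition, which gives differentiability at all nearby points.
  have hd : ∀ᶠ y in 𝓝 x, MDifferentiableAt (𝓡 7) 𝓘(ℝ, F) f y :=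
    ((contMDiffAt_iff_contMDiffAt_nhds (by simp)).1 hf).mono fun y hy =>
      hy.mdifferentiableAt two_ne_zero
  have hd' := (continuousAt_extChartAt_symm (I := 𝓡 7) x).eventually
    (by rwa [extChartAt_to_inv])
  filter_upwards [extChartAt_target_mem_nhds (I := 𝓡 7) x, hd'] with z hz hz'
  exact fderiv_comp_extChartAt_symm x Y f z hz hz'

theorem differentiableAt_mpullbackWithin {Y : Π x : S7, TangentSpace (𝓡 7) x} {x : S7}
    (hY : MDifferentiableAt (𝓡 7) ((𝓡 7).prod 𝓘(ℝ, EuclideanSpace ℝ (Fin 7)))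
      (fun y => TotalSpace.mk' (EuclideanSpace ℝ (Fin 7)) y (Y y)) x) :
    DifferentiableAt ℝ (mpullbackWithin 𝓘(ℝ, EuclideanSpace ℝ (Fin 7)) (𝓡 7)
      (extChartAt (𝓡 7) x).symm Y (Set.range (𝓡 7))) (extChartAt (𝓡 7) x x) := by
  have hr : Set.range (𝓡 7) = Set.univ := by simp
  have h :=
    (mdifferentiableWithinAt_univ.2 hY).differentiableWithinAt_mpullbackWithin_vectorField
  rw [hr, Set.preimage_univ, Set.univ_inter] at h
  rw [hr]
  exact differentiableWithinAt_univ.1 h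

theorem contDiffAt_comp_extChartAt_symm {F : Type*} [NormedAddCommGroup F] [NormedSpace ℝ F]
    {f : S7 → F} {x : S7} (hf : ContMDiffAt (𝓡 7) 𝓘(ℝ, F) 2 f x) :
    ContDiffAt ℝ 2 (f ∘ (extChartAt (𝓡 7) x).symm) (extChartAt (𝓡 7) x x) := by
  have h1 := (contMDiffOn_extChartAt_symm (I := 𝓡 7) (n := 2) x).contMDiffAt
    (extChartAt_target_mem_nhds (I := 𝓡 7) x)
  have hf' : ContMDiffAt (𝓡 7) 𝓘(ℝ, F) 2 f ((extChartAt (𝓡 7) x).symm (extChartAt (𝓡 7) x x)) := by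
    rwa [extChartAt_to_inv]
  exact (hf'.comp (extChartAt (𝓡 7) x x) h1).contDiffAt

theorem mdifferentiableAt_of_comp_extChartAt_symm {F : Type*} [NormedAddCommGroup F]
    [NormedSpace ℝ F] {f : S7 → F} {x : S7}
    (hf : DifferentiableAt ℝ (f ∘ (extChartAt (𝓡 7) x).symm) (extChartAt (𝓡 7) x x)) :
    MDifferentiableAt (𝓡 7) 𝓘(ℝ, F) f x := by
  have hdφ := mdifferentiableAt_extChartAt (I := 𝓡 7)
    (mem_chart_source (EuclideanSpace ℝ (Fin 7)) x)
  refine (hf.mdifferentiableAt.comp x hdφ).congr_of_eventuallyEq ?_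
  filter_upwards [extChartAt_source_mem_nhds (I := 𝓡 7) x] with y hy
  exact congrArg f ((extChartAt (𝓡 7) x).left_inv hy).symm

theorem mdifferentiableAt_mvfderiv_apply {F : Type*} [NormedAddCommGroup F] [NormedSpace ℝ F]
    {f : S7 → F} {x : S7} (hf : ContMDiffAt (𝓡 7) 𝓘(ℝ, F) 2 f x)
    {Y : Π x : S7, TangentSpace (𝓡 7) x}
    (hY : MDifferentiableAt (𝓡 7) ((𝓡 7).prod 𝓘(ℝ, EuclideanSpace ℝ (Fin 7)))
      (fun y => TotalSpace.mk' (EuclideanSpace ℝ (Fin 7)) y (Y y)) x) :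
    MDifferentiableAt (𝓡 7) 𝓘(ℝ, F) (fun y => mvfderiv (𝓡 7) f y (Y y)) x := by
  refine mdifferentiableAt_of_comp_extChartAt_symm ?_
  have h1 : DifferentiableAt ℝ (fderiv ℝ (f ∘ (extChartAt (𝓡 7) x).symm))
      (extChartAt (𝓡 7) x x) :=
    ((contDiffAt_comp_extChartAt_symm hf).fderiv_right (m := 1) (by norm_num)).differentiableAt
      one_ne_zero
  exact (h1.clm_apply (differentiableAt_mpullbackWithin hY)).congr_of_eventuallyEq
    (eventuallyEq_fderiv_mpullbackWithin hf Y).symm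

/-- In the chart at x this is the symmetry of the second derivative of a C² map. It is used with f =
`ambient Z`, to cancel the second derivatives of Z in the curvature. -/
theorem mvfderiv_mlieBracket {F : Type*} [NormedAddCommGroup F] [NormedSpace ℝ F]
    {f : S7 → F} {x : S7} (hf : ContMDiffAt (𝓡 7) 𝓘(ℝ, F) 2 f x)
    {X Y : Π x : S7, TangentSpace (𝓡 7) x}
    (hX : MDifferentiableAt (𝓡 7) ((𝓡 7).prod 𝓘(ℝ, EuclideanSpace ℝ (Fin 7)))
      (fun y => TotalSpace.mk' (EuclideanSpace ℝ (Fin 7)) y (X y)) x)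
    (hY : MDifferentiableAt (𝓡 7) ((𝓡 7).prod 𝓘(ℝ, EuclideanSpace ℝ (Fin 7)))
      (fun y => TotalSpace.mk' (EuclideanSpace ℝ (Fin 7)) y (Y y)) x) :
    mvfderiv (𝓡 7) f x (mlieBracket (𝓡 7) X Y x) =
      mvfderiv (𝓡 7) (fun y => mvfderiv (𝓡 7) f y (Y y)) x (X x)
        - mvfderiv (𝓡 7) (fun y => mvfderiv (𝓡 7) f y (X y)) x (Y x) := by
  have hr : Set.range (𝓡 7) = Set.univ := by simp
  have hx : (extChartAt (𝓡 7) x).symm (extChartAt (𝓡 7) x x) = x := extChartAt_to_inv x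
  have hdX := differentiableAt_mpullbackWithin hX
  have hdY := differentiableAt_mpullbackWithin hY
  have key := fderiv_apply_lieBracket (contDiffAt_comp_extChartAt_symm hf) (by simp) hdY hdX
  rw [(eventuallyEq_fderiv_mpullbackWithin hf Y).fderiv_eq,
    (eventuallyEq_fderiv_mpullbackWithin hf X).fderiv_eq] at key
  have e1 := fderiv_comp_extChartAt_symm x X
    (fun y => mvfderiv (𝓡 7) f y (Y y)) (extChartAt (𝓡 7) x x) (mem_extChartAt_target x)
    (by rw [hx]; exact mdifferentiableAt_mvfderiv_apply hf hY)
  have e2 := fderiv_comp_extChartAt_symm x Y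
    (fun y => mvfderiv (𝓡 7) f y (X y)) (extChartAt (𝓡 7) x x) (mem_extChartAt_target x)
    (by rw [hx]; exact mdifferentiableAt_mvfderiv_apply hf hX)
  rw [e1, e2, hx] at key
  have hbr : mlieBracket (𝓡 7) X Y x =
      (mfderiv (𝓡 7) 𝓘(ℝ, EuclideanSpace ℝ (Fin 7)) (extChartAt (𝓡 7) x) x).inverse
        (lieBracket (E := EuclideanSpace ℝ (Fin 7)) ℝ
          (mpullbackWithin 𝓘(ℝ, EuclideanSpace ℝ (Fin 7)) (𝓡 7) (extChartAt (𝓡 7) x).symm X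
            (Set.range (𝓡 7)))
          (mpullbackWithin 𝓘(ℝ, EuclideanSpace ℝ (Fin 7)) (𝓡 7) (extChartAt (𝓡 7) x).symm Y
            (Set.range (𝓡 7))) (extChartAt (𝓡 7) x x)) := by
    rw [← mlieBracketWithin_univ, mlieBracketWithin_apply, hr, Set.preimage_univ, Set.univ_inter]
    exact congrArg _ (congrFun lieBracketWithin_univ _)
  have hdφ := mdifferentiableAt_extChartAt (I := 𝓡 7)
    (mem_chart_source (EuclideanSpace ℝ (Fin 7)) x)
  have hfd : MDifferentiableAt 𝓘(ℝ, EuclideanSpace ℝ (Fin 7)) 𝓘(ℝ, F)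
      (f ∘ (extChartAt (𝓡 7) x).symm) (extChartAt (𝓡 7) x x) :=
    ((contDiffAt_comp_extChartAt_symm hf).differentiableAt two_ne_zero).mdifferentiableAt
  have hcomp := (hfd.hasMFDerivAt.comp x hdφ.hasMFDerivAt).congr_of_eventuallyEq (f₁ := f) (by
    filter_upwards [extChartAt_source_mem_nhds (I := 𝓡 7) x] with y hy
    exact congrArg f ((extChartAt (𝓡 7) x).left_inv hy).symm)
  have hi := isInvertible_mfderiv_extChartAt (I := 𝓡 7) (mem_extChartAt_source (I := 𝓡 7) x)
  have e3 : mvfderiv (𝓡 7) f x =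
      (fderiv ℝ (f ∘ (extChartAt (𝓡 7) x).symm) (extChartAt (𝓡 7) x x)) ∘L
        (mfderiv (𝓡 7) 𝓘(ℝ, EuclideanSpace ℝ (Fin 7)) (extChartAt (𝓡 7) x) x) := by
    rw [← mfderiv_eq_fderiv]
    exact hcomp.mfderiv
  rw [← key, hbr, e3]
  exact congrArg (fderiv ℝ (f ∘ (extChartAt (𝓡 7) x).symm) (extChartAt (𝓡 7) x x))
    (hi.self_apply_inverse _)

/-! ### The curvature of the connection -/

/-- Differentiate ⟨Z, x⟩ = 0: this is the second fundamental form of the sphere. -/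
theorem mvfderiv_ambient_inner_self {Z : Π x : S7, TangentSpace (𝓡 7) x} {x : S7}
    (hZ : MDifferentiableAt (𝓡 7) 𝓘(ℝ, C4) (ambient Z) x) (u : TangentSpace (𝓡 7) x) :
    inner ℝ (mvfderiv (𝓡 7) (ambient Z) x u) (x : C4) = -inner ℝ (ambient Z x) (incl x u) := by
  have hcoe : MDifferentiableAt (𝓡 7) 𝓘(ℝ, C4) ((↑) : S7 → C4) x :=
    (contMDiff_coe_sphere (E := C4) (n := 7) (m := 1) x).mdifferentiableAt one_ne_zero
  have h := mvfderiv_inner hZ hcoe u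
  have h0 : (fun y : S7 => (inner ℝ (ambient Z y) (y : C4) : ℝ)) = fun _ => 0 :=
    funext fun y => inner_incl_self y (Z y)
  rw [h0, mvfderiv_const] at h
  exact eq_neg_of_add_eq_zero_left h.symm

theorem inner_skewConnection (r : ℝ) (q : ℂ) (Z : Π x : S7, TangentSpace (𝓡 7) x) (x : S7)
    (u t : TangentSpace (𝓡 7) x) :
    inner ℝ (skewConnection r q Z x u) t = inner ℝ (mvfderiv (𝓡 7) (ambient Z) x u) (incl x t)
      + inner ℝ (ambientDiff r q x (incl x u) (ambient Z x)) (incl x t) := by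
  rw [skewConnection_apply, inner_add_left, leviCivita_apply, inner_tangentPart,
    inner_eq x (skewDiff r q x u (Z x)), incl_skewDiff]
  rfl

/-- The normal correction must be explicit here, since the expression is differentiated again: the
derivative of ⟨Z, Y⟩x has the tangential part ⟨Z, Y⟩u, the source of the constant-curvature term. -/
theorem incl_skewConnection (r : ℝ) (q : ℂ) {Z : Π x : S7, TangentSpace (𝓡 7) x} {x : S7}
    (hZ : MDifferentiableAt (𝓡 7) 𝓘(ℝ, C4) (ambient Z) x) (u : TangentSpace (𝓡 7) x) :
    incl x (skewConnection r q Z x u) = mvfderiv (𝓡 7) (ambient Z) x u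
      + (inner ℝ (ambient Z x) (incl x u) : ℝ) • (x : C4)
      + ambientDiff r q x (incl x u) (ambient Z x) := by
  rw [skewConnection_apply, map_add, leviCivita_apply, incl_tangentPart, incl_skewDiff,
    mvfderiv_ambient_inner_self hZ, neg_smul, sub_neg_eq_add]
  rfl

theorem inner_skewConnection_skewConnection (r : ℝ) (q : ℂ) {Y Z : Π x : S7, TangentSpace (𝓡 7) x}
    {x : S7} (hY : MDifferentiableAt (𝓡 7) ((𝓡 7).prod 𝓘(ℝ, EuclideanSpace ℝ (Fin 7)))
      (fun y => TotalSpace.mk' (EuclideanSpace ℝ (Fin 7)) y (Y y)) x)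
    (hZ : ContMDiffAt (𝓡 7) 𝓘(ℝ, C4) 2 (ambient Z) x) (u t : TangentSpace (𝓡 7) x) :
    inner ℝ (skewConnection r q (fun y => skewConnection r q Z y (Y y)) x u) t =
      inner ℝ (mvfderiv (𝓡 7) (fun y => mvfderiv (𝓡 7) (ambient Z) y (Y y)) x u
        + (inner ℝ (ambient Z x) (ambient Y x) : ℝ) • incl x u
        + ambientDiff r q (incl x u) (ambient Y x) (ambient Z x)
        + ambientDiff r q x (mvfderiv (𝓡 7) (ambient Y) x u) (ambient Z x)
        + ambientDiff r q x (ambient Y x) (mvfderiv (𝓡 7) (ambient Z) x u)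
        + ambientDiff r q x (incl x u) (mvfderiv (𝓡 7) (ambient Z) x (Y x))
        + ambientDiff r q x (incl x u) (ambientDiff r q x (ambient Y x) (ambient Z x)))
        (incl x t) := by
  have hcoe : MDifferentiableAt (𝓡 7) 𝓘(ℝ, C4) ((↑) : S7 → C4) x :=
    (contMDiff_coe_sphere (E := C4) (n := 7) (m := 1) x).mdifferentiableAt one_ne_zero
  have hY' := mdifferentiableAt_ambient hY
  have hZ' := hZ.mdifferentiableAt two_ne_zero
  have hev : ambient (fun y => skewConnection r q Z y (Y y)) =ᶠ[𝓝 x] fun y =>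
      (mvfderiv (𝓡 7) (ambient Z) y (Y y)
        + innerSL ℝ (ambient Z y) (ambient Y y) • (y : C4))
        + ambientDiff r q y (ambient Y y) (ambient Z y) := by
    filter_upwards [(contMDiffAt_iff_contMDiffAt_nhds (by simp)).1 hZ] with y hy
    exact incl_skewConnection r q (hy.mdifferentiableAt two_ne_zero) (Y y)
  have h1 := mdifferentiableAt_mvfderiv_apply hZ hY
  have h2 := mvfderiv_bilinear (innerSL ℝ) hZ' hY' u
  have h3 := mvfderiv_bilinear (ContinuousLinearMap.lsmul ℝ ℝ) h2.1 hcoe u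
  have h4 := mvfderiv_trilinear (ambientDiff r q) hcoe hY' hZ' u
  have hd : mvfderiv (𝓡 7) (ambient (fun y => skewConnection r q Z y (Y y))) x u =
      mvfderiv (𝓡 7) (fun y => mvfderiv (𝓡 7) (ambient Z) y (Y y)) x u
        + mvfderiv (𝓡 7) (fun y : S7 => innerSL ℝ (ambient Z y) (ambient Y y) • (y : C4)) x u
        + mvfderiv (𝓡 7) (fun y : S7 => ambientDiff r q y (ambient Y y) (ambient Z y)) x u := by
    have e1 : mvfderiv (𝓡 7) (ambient (fun y => skewConnection r q Z y (Y y))) x = _ :=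
      hev.mfderiv_eq
    rw [e1]
    have e2 := mvfderiv_add (h1.add h3.1) h4.1
    rw [mvfderiv_add h1 h3.1] at e2
    exact congrArg (fun L => L u) e2
  rw [inner_skewConnection, hd, hev.self_of_nhds]
  have h3' : mvfderiv (𝓡 7) (fun y : S7 => innerSL ℝ (ambient Z y) (ambient Y y) • (y : C4)) x u =
      (mvfderiv (𝓡 7) (fun y : S7 => innerSL ℝ (ambient Z y) (ambient Y y)) x u) • (x : C4)
        + (inner ℝ (ambient Z x) (ambient Y x) : ℝ) • incl x u := h3.2
  have h4' : mvfderiv (𝓡 7) (fun y : S7 => ambientDiff r q y (ambient Y y) (ambient Z y)) x u =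
      ambientDiff r q (incl x u) (ambient Y x) (ambient Z x)
        + ambientDiff r q x (mvfderiv (𝓡 7) (ambient Y) x u) (ambient Z x)
        + ambientDiff r q x (ambient Y x) (mvfderiv (𝓡 7) (ambient Z) x u) := h4.2
  rw [h3', h4']
  -- Multiples of x disappear, either against the tangent vector t or because T(x, u, x) = 0.
  simp only [map_add, map_smul, ambientDiff_self_outer, smul_zero, add_zero, inner_add_left,
    real_inner_smul_left, inner_self_incl, mul_zero, zero_add]
  ring

/-- All derivatives of the fields cancel: second derivatives of Z and derivatives of X, Y against
the bracket term, and the terms T(x, X, dZ(Y)) + T(x, Y, dZ(X)) because they are symmetric in X and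
Y. The two derivatives of the position slot add up to 2T(X, Y, Z). -/
theorem inner_curvatureField (r : ℝ) (q : ℂ) {X Y Z : Π x : S7, TangentSpace (𝓡 7) x} {x : S7}
    (hX : MDifferentiableAt (𝓡 7) ((𝓡 7).prod 𝓘(ℝ, EuclideanSpace ℝ (Fin 7)))
      (fun y => TotalSpace.mk' (EuclideanSpace ℝ (Fin 7)) y (X y)) x)
    (hY : MDifferentiableAt (𝓡 7) ((𝓡 7).prod 𝓘(ℝ, EuclideanSpace ℝ (Fin 7)))
      (fun y => TotalSpace.mk' (EuclideanSpace ℝ (Fin 7)) y (Y y)) x)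
    (hZ : ContMDiffAt (𝓡 7) 𝓘(ℝ, C4) 2 (ambient Z) x) (t : TangentSpace (𝓡 7) x) :
    inner ℝ ((skewConnection r q).curvatureField X Y Z x) t =
      inner ℝ ((inner ℝ (ambient Z x) (ambient Y x) : ℝ) • ambient X x
        - (inner ℝ (ambient Z x) (ambient X x) : ℝ) • ambient Y x
        + (2 : ℝ) • ambientDiff r q (ambient X x) (ambient Y x) (ambient Z x)
        + ambientDiff r q x (ambient X x) (ambientDiff r q x (ambient Y x) (ambient Z x))
        - ambientDiff r q x (ambient Y x) (ambientDiff r q x (ambient X x) (ambient Z x)))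
        (incl x t) := by
  rw [CovariantDerivative.curvatureField, inner_sub_left, inner_sub_left,
    inner_skewConnection_skewConnection r q hY hZ, inner_skewConnection_skewConnection r q hX hZ,
    inner_skewConnection, mvfderiv_mlieBracket hZ hX hY, incl_mlieBracket hX hY,
    ← inner_sub_left, ← inner_add_left, ← inner_sub_left]
  congr 1
  have h := ambientDiff_swap_left r q (ambient X x) (ambient Y x) (ambient Z x)
  change _ - (_ + _ + ambientDiff r q (ambient Y x) (ambient X x) (ambient Z x) + _ + _ + _ + _)
    - _ = _
  rw [h]
  simp only [map_sub, sub_apply, ambient]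
  module

theorem inner_curvature (r : ℝ) (q : ℂ) (x : S7) (u v w t : TangentSpace (𝓡 7) x) :
    inner ℝ ((skewConnection r q).curvature x u v w) t =
      inner ℝ ((inner ℝ (incl x w) (incl x v) : ℝ) • incl x u
        - (inner ℝ (incl x w) (incl x u) : ℝ) • incl x v
        + (2 : ℝ) • ambientDiff r q (incl x u) (incl x v) (incl x w)
        + ambientDiff r q x (incl x u) (ambientDiff r q x (incl x v) (incl x w))
        - ambientDiff r q x (incl x v) (ambientDiff r q x (incl x u) (incl x w)))
        (incl x t) := by
  have h := inner_curvatureField r q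
    (mdifferentiableAt_extend (𝓡 7) (EuclideanSpace ℝ (Fin 7)) u)
    (mdifferentiableAt_extend (𝓡 7) (EuclideanSpace ℝ (Fin 7)) v)
    (contMDiffAt_ambient (contMDiffAt_extend (𝓡 7) (EuclideanSpace ℝ (Fin 7)) w)) t
  simp only [ambient, extend_apply_self] at h
  exact h

/-! ### Ricci tensor and scalar curvature. -/

theorem ricci_skewConnection (r : ℝ) (q : ℂ) (x : S7) (v w : TangentSpace (𝓡 7) x) :
    (skewConnection r q).ricci x v w = (6 - 2 * r ^ 2 - 4 * ‖q‖ ^ 2) * inner ℝ v w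
      + 4 * (‖q‖ ^ 2 - r ^ 2) * (eta quatI x v * eta quatI x w) := by
  have h : ∀ i, inner ℝ ((skewConnection r q).curvature x
        (stdOrthonormalBasis ℝ (TangentSpace (𝓡 7) x) i) v w)
        (stdOrthonormalBasis ℝ (TangentSpace (𝓡 7) x) i) =
      inner ℝ v w * inner ℝ (incl x (stdOrthonormalBasis ℝ (TangentSpace (𝓡 7) x) i))
          (incl x (stdOrthonormalBasis ℝ (TangentSpace (𝓡 7) x) i))
        - inner ℝ (incl x w) (incl x (stdOrthonormalBasis ℝ (TangentSpace (𝓡 7) x) i))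
          * inner ℝ (incl x v) (incl x (stdOrthonormalBasis ℝ (TangentSpace (𝓡 7) x) i))
        - inner ℝ (ambientDiff r q x (incl x v)
            (incl x (stdOrthonormalBasis ℝ (TangentSpace (𝓡 7) x) i)))
          (ambientDiff r q x (incl x w)
            (incl x (stdOrthonormalBasis ℝ (TangentSpace (𝓡 7) x) i))) := fun i => by
    generalize stdOrthonormalBasis ℝ (TangentSpace (𝓡 7) x) i = e
    rw [inner_curvature, ambientDiff_swap_left r q (incl x v) (incl x e) (incl x w)]
    simp only [inner_add_left, inner_sub_left, real_inner_smul_left, inner_ambientDiff_self_mid,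
      inner_neg_left]
    -- Of the terms in T only -⟨A_v A_e w, e⟩ is left; moving A_v across and using A_e w = -A_w e
    -- makes it -⟨A_v e, A_w e⟩.
    rw [inner_ambientDiff_swap r q x (incl x v) (incl x e), inner_eq x v w,
      real_inner_comm (incl x w) (incl x v),
      ambientDiff_swap_right r q x (incl x w) (incl x e), inner_neg_right]
    ring
  rw [CovariantDerivative.ricci]
  rw [Finset.sum_congr rfl fun i _ => h i, Finset.sum_sub_distrib, Finset.sum_sub_distrib,
    ← Finset.mul_sum, sum_inner_self, sum_inner_mul_inner, sum_inner_ambientDiff, inner_incl_self,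
    real_inner_comm (incl x v), ← inner_eq]
  ring

theorem symRicci_skewConnection (r : ℝ) (q : ℂ) (x : S7) (v w : TangentSpace (𝓡 7) x) :
    (skewConnection r q).symRicci x v w = (6 - 2 * r ^ 2 - 4 * ‖q‖ ^ 2) * inner ℝ v w
      + 4 * (‖q‖ ^ 2 - r ^ 2) * (eta quatI x v * eta quatI x w) := by
  rw [CovariantDerivative.symRicci, ricci_skewConnection, ricci_skewConnection,
    real_inner_comm v w]
  ring

theorem scalarCurvature_skewConnection (r : ℝ) (q : ℂ) (x : S7) :
    (skewConnection r q).scalarCurvature x = 6 * (7 - 3 * r ^ 2 - 4 * ‖q‖ ^ 2) := by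
  -- η₁ has norm 1: J₁x is a unit vector orthogonal to x.
  have h := sum_inner_mul_inner x (quatI x) (quatI x)
  rw [inner_quatI_quatI, inner_self_self, inner_quatI_self] at h
  have h1 := sum_inner_self x
  rw [CovariantDerivative.scalarCurvature]
  simp only [ricci_skewConnection, eta, inner_quatI_swap _ (x : C4), inner_eq]
  rw [Finset.sum_add_distrib, ← Finset.mul_sum, ← Finset.mul_sum, h1]
  simp only [neg_mul_neg]
  rw [h]
  ring

/-! ### Metric compatibility and torsion -/

theorem isMetric_skewConnection (r : ℝ) (q : ℂ) : (skewConnection r q).IsMetric := by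
  rw [CovariantDerivative.isMetric_iff]
  intro x X Y Z hX hY hZ
  have h := (CovariantDerivative.isMetric_iff leviCivita).1 isMetric_leviCivita x X Y Z hX hY hZ
  rw [h, skewConnection_apply, skewConnection_apply, inner_add_left, inner_add_right,
    inner_eq x (skewDiff r q x (X x) (Y x)), inner_eq x (Y x) (skewDiff r q x (X x) (Z x)),
    incl_skewDiff, incl_skewDiff, real_inner_comm (ambientDiff r q x (incl x (X x)) _),
    inner_ambientDiff_swap r q x (incl x (X x)) (incl x (Y x)) (incl x (Z x))]
  ring

/-- ∇^g has no torsion, so the torsion of ∇ is A_u v - A_v u, and A is skew in u and v. -/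
theorem incl_torsion_skewConnection (r : ℝ) (q : ℂ) (x : S7) (u v : TangentSpace (𝓡 7) x) :
    incl x ((skewConnection r q).torsion x u v) =
      (2 : ℝ) • ambientDiff r q x (incl x u) (incl x v) := by
  have h := congrArg (fun T => T x u v) torsion_leviCivita
  rw [CovariantDerivative.torsion_apply_eq_extend] at h ⊢
  rw [skewConnection_apply, skewConnection_apply]
  simp only [extend_apply_self] at h ⊢
  have h' : ∀ a b c d e : TangentSpace (𝓡 7) x, a - b - e = 0 → a + c - (b + d) - e = c - d :=
    fun a b c d e he => by rw [← add_zero (c - d), ← he]; module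
  rw [h' _ _ _ _ _ h, map_sub, incl_skewDiff, incl_skewDiff,
    ambientDiff_swap_right r q x (incl x u) (incl x v)]
  module

theorem hasTotallySkewTorsion_skewConnection (r : ℝ) (q : ℂ) :
    (skewConnection r q).HasTotallySkewTorsion := by
  intro x u v w
  simp only [inner_eq, incl_torsion_skewConnection, real_inner_smul_left]
  rw [ambientDiff_swap_right r q x (incl x u) (incl x v), inner_neg_left,
    inner_ambientDiff_swap r q x (incl x u) (incl x v) (incl x w)]
  constructor <;> ring

/-! ### The Einstein condition. -/

theorem isEinstein_skewConnection_iff (r : ℝ) (q : ℂ) :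
    (skewConnection r q).IsEinsteinWithSkewTorsion ↔ ‖q‖ ^ 2 = r ^ 2 := by
  constructor
  · intro h
    obtain ⟨x⟩ : Nonempty S7 := (NormedSpace.sphere_nonempty.2 zero_le_one).to_subtype
    -- Test on v = J₁x = -ξ₁, where η₁(v)² = ⟨v, v⟩ = 1: the equation becomes 6 - 6r² = 6(7 - 3r² -
    -- 4|q|²)/7, that is, |q|² = r².
    obtain ⟨v, hv⟩ := exists_incl_eq x (inner_quatI_self (x : C4))
    have h1 := h.einstein x v v
    rw [symRicci_skewConnection, scalarCurvature_skewConnection, finrank_euclideanSpace_fin,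
      inner_eq, eta, hv, quatI_quatI, inner_neg_left, inner_quatI_quatI, inner_self_self] at h1
    push_cast at h1
    linarith
  · intro h
    refine ⟨isMetric_skewConnection r q, hasTotallySkewTorsion_skewConnection r q,
      fun x v w => ?_⟩
    rw [symRicci_skewConnection, scalarCurvature_skewConnection, finrank_euclideanSpace_fin, h]
    push_cast
    ring

end S7

theorem mainTheorem6 (r : ℝ) (q : ℂ) :
    (∀ (x : S7) (v w : TangentSpace (𝓡 7) x),
      (S7.skewConnection r q).symRicci x v w =
        (6 - 2 * r ^ 2 - 4 * ‖q‖ ^ 2) * inner ℝ v w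
          + 4 * (‖q‖ ^ 2 - r ^ 2) * (S7.eta S7.quatI x v * S7.eta S7.quatI x w)) ∧
    (∀ x : S7, (S7.skewConnection r q).scalarCurvature x =
      6 * (7 - 3 * r ^ 2 - 4 * ‖q‖ ^ 2)) ∧
    ((S7.skewConnection r q).IsEinsteinWithSkewTorsion ↔ ‖q‖ ^ 2 = r ^ 2) ∧
    (‖q‖ ^ 2 = r ^ 2 → ∀ (x : S7) (v w : TangentSpace (𝓡 7) x),
      (S7.skewConnection r q).symRicci x v w = 6 * (1 - r ^ 2) * inner ℝ v w) := by
  refine ⟨S7.symRicci_skewConnection r q, S7.scalarCurvature_skewConnection r q,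
    S7.isEinstein_skewConnection_iff r q, fun h x v w => ?_⟩
  rw [S7.symRicci_skewConnection, h]
  ring
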